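/- Notation. Let $\mathbb H^2_{\mathbb C}=\{(\eta,\omega,\psi,\chi)\in\mathbb R^4:\eta>0\}$ carry the Riemannian metric $$g_H=\frac{d\eta^2}{\eta^2}+\frac{(d\omega+2\chi\,d\psi-2\psi\,d\chi)^2}{\eta^2}+4\,\frac{d\chi^2+d\psi^2}{\eta}.$$ For $0<\theta_1<\theta_2<\pi$ and (absolutely continuous) potentials $\mathcal D=(\sigma,\omega,\psi,\chi)$ on $[\theta_1,\theta_2]$ put $\eta=e^{\sigma}\sin^2\theta$ and $$\mathcal M_{\theta_1,\theta_2}(\mathcal D)=\int_{\theta_1}^{\theta_2}\Big(\sigma'^2+4\sigma+\frac{(\omega'+2\chi\psi'-2\psi\chi')^2}{\eta^2}+4\,\frac{\psi'^2+\chi'^2}{\eta}\Big)\sin\theta\,d\theta ,$$ and for (absolutely continuous) curves $\gamma=(\eta,\omega,\psi,\chi)$ in $\mathbb H^2_{\mathbb C}$ put $\tilde{\mathcal M}_{t_1,t_2}(\gamma)=\int_{t_1}^{t_2}g_H(\dot\gamma,\dot\gamma)\,dt$. Both are considered on the objects for which the integral is finite. Write $t=\ln\tan\frac\theta2$; potentials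 $\mathcal D$ as functions of $\theta$ give the curve $\gamma(t)=(\eta,\omega,\psi,\chi)(t)$, and $t_j=\ln\tan\frac{\theta_j}2$. **Lemma.** (1) Let $0<\theta_1<\theta_2<\pi$. For arbitrary Dirichlet data $\mathcal D(\theta_1),\mathcal D(\theta_2)\in\mathbb R^4$ the functional $\mathcal M_{\theta_1,\theta_2}$ has a unique minimizer $\mathcal D=(\sigma,\omega,\psi,\chi)$, and it is smooth on $[\theta_1,\theta_2]$. Moreover $\gamma(t)=\xi(\alpha t+\beta)$ for $t\in[t_1,t_2]$, where $\alpha\ge 0$ and $\xi$ is a geodesic of $\mathbb H^2_{\mathbb C}$ parametrized by arc length, and this arc is length minimizing: ${\rm dist}_{\mathbb H^2_{\mathbb C}}(\gamma(t_1),\gamma(t_2))=\alpha(t_2-t_1)$. (2) Let $t_1<0$, $\eta_1>0$, $\omega_1\neq0$, $\psi_1\in\mathbb R$. There are constants $c_1\ne0$, $c_3$, $c_4$, $c_5=2c_1c_4$ and $\alpha>0$, uniquely determined by the boundary conditions below, such that the curve $$\eta=\Big(\tfrac12c_5^2+\tfrac12\sqrt{4c_1^2+c_5^4}\,\cosh\alpha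 t\Big)^{-1},$$ $$\chi+i\psi=c_4e^{if}+\frac{c_3}{c_1},\qquad f=-2\arctan\Big(\frac{\sqrt{4c_1^2+c_5^4}-c_5^2}{2c_1}\tanh\frac{\alpha t}2\Big),$$ $$\omega=\frac{{\rm sgn}(t)}{c_1}\sqrt{1-c_1^2\eta^2-4c_1^2c_4^2\eta}-\frac{2c_3}{c_1}\psi$$ satisfies the centered boundary conditions $(\eta,\omega,\psi,\chi)(t_1)=(\eta_1,\omega_1,\psi_1,0)$ and $(\eta,\omega,\psi,\chi)(-t_1)=(\eta_1,-\omega_1,-\psi_1,0)$. This curve is the unique minimizer of $\tilde{\mathcal M}_{t_1,-t_1}$ with these boundary values, and on $[t_1,-t_1]$ it has the form $\xi(\alpha t+\beta)$ as in (1), with the same $\alpha$. (3) Let $J,Q,\sigma_l\in\mathbb R$ with $(J,Q)\neq(0,0)$, and define $\Gamma$ by $\sigma_l=\frac12\ln(Q^4+4J^2)+\Gamma$. Let $\theta^i\in(0,\pi/2)$ with $\theta^i\to0$, and let $\sigma_1^i\to\sigma_l$, $\omega_1^i\to-4J$, $\psi_1^i\to-Q$ be real sequences with $\omega_1^i\ne0$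 for all $i$. Then the unique minimizer $\mathcal D^i=(\sigma^i,\omega^i,\psi^i,\chi^i)$ of $\mathcal M_{\theta^i,\pi-\theta^i}$ with $\mathcal D^i(\theta^i)=(\sigma_1^i,\omega_1^i,\psi_1^i,0)$ and $\mathcal D^i(\pi-\theta^i)=(\sigma_1^i,-\omega_1^i,-\psi_1^i,0)$ corresponds to a curve as in (2), with constants $c_1^i,c_3^i,c_4^i,c_5^i,\alpha^i$; in particular $$\sigma^i(\theta)=-\ln\Big[\tfrac12(c_5^i)^2\sin^2\theta+\tfrac12\sqrt{4(c_1^i)^2+(c_5^i)^4}\,\sin^2\theta\cosh\alpha^it\Big],\qquad t=\ln\tan\tfrac\theta2 ,$$ on $[\theta^i,\pi-\theta^i]$, and as $i\to\infty$ $$\alpha^i\to2,\qquad c_5^i\to\frac{-Q}{\sqrt{Q^4+4J^2}},\qquad c_1^i\to\frac{J}{Q^4+4J^2},\qquad \Big(\frac{\theta^i}2\Big)^{\alpha^i-2}\to e^{\Gamma}.$$ -/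

import Mathlib

open Set Filter Topology
open scoped Real ContDiff

noncomputable section

namespace CH2

/-! ### The complex hyperbolic plane

A point of the complex hyperbolic plane is a vector `x : Fin 4 → ℝ` with coordinates
`(x 0, x 1, x 2, x 3) = (η, ω, ψ, χ)` and `η = x 0 > 0`. -/

/-- The one-form `dω + 2 χ dψ - 2 ψ dχ` at the point `(η, ω, ψ, χ)`. -/
def contactForm (x v : Fin 4 → ℝ) : ℝ :=
  v 1 + 2 * x 3 * v 2 - 2 * x 2 * v 3

/-- The Riemannian metric
`g_H = dη² / η² + (dω + 2 χ dψ - 2 ψ dχ)² / η² + 4 (dχ² + dψ²) / η`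
at the point `x`, as a bilinear form in the tangent vectors `v`, `w`. -/
def gH (x v w : Fin 4 → ℝ) : ℝ :=
  v 0 * w 0 / x 0 ^ 2 + contactForm x v * contactForm x w / x 0 ^ 2
    + 4 * (v 3 * w 3 + v 2 * w 2) / x 0

/-- The `k`-th coordinate vector field. -/
def coordVec (k : Fin 4) : Fin 4 → ℝ := Pi.single k 1

/-- The components `g_{ij}` of the metric in the coordinates `(η, ω, ψ, χ)`. -/
def gComp (i j : Fin 4) (x : Fin 4 → ℝ) : ℝ := gH x (coordVec i) (coordVec j)

/-- The partial derivative `∂_k F` at `x`. -/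
def partialD (k : Fin 4) (F : (Fin 4 → ℝ) → ℝ) (x : Fin 4 → ℝ) : ℝ :=
  fderiv ℝ F x (coordVec k)

/-- The Christoffel symbols of the Levi-Civita connection with the upper index lowered,
`Γ_{k,ij} = (∂_i g_{jk} + ∂_j g_{ik} - ∂_k g_{ij}) / 2`. -/
def christoffel (k i j : Fin 4) (x : Fin 4 → ℝ) : ℝ :=
  (partialD i (gComp j k) x + partialD j (gComp i k) x - partialD k (gComp i j) x) / 2

/-- `ξ` is a (complete) geodesic of the complex hyperbolic plane, parametrized by arc length: a
smooth unit speed curve with vanishing covariant acceleration, the equation `∇_{ξ'} ξ' = 0` being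
written with its free index lowered, `g_{kj} ξ''^j + Γ_{k,ij} ξ'^i ξ'^j = 0`. -/
structure IsUnitSpeedGeodesic (ξ : ℝ → Fin 4 → ℝ) : Prop where
  smooth : ContDiff ℝ ∞ ξ
  pos : ∀ s, 0 < ξ s 0
  unit_speed : ∀ s, gH (ξ s) (deriv ξ s) (deriv ξ s) = 1
  geodesic : ∀ s k,
    ∑ j, gComp k j (ξ s) * deriv (deriv ξ) s j
      + ∑ i, ∑ j, christoffel k i j (ξ s) * deriv ξ s i * deriv ξ s j = 0

/-- The Riemannian length of a curve `c : [0, 1] → ℍ²_ℂ`. -/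
def curveLength (c : ℝ → Fin 4 → ℝ) : ℝ :=
  ∫ s in (0 : ℝ)..1, √(gH (c s) (deriv c s) (deriv c s))

/-- The Riemannian distance: the infimum of the lengths of the `C¹` curves from `x` to `y`. -/
def hdist (x y : Fin 4 → ℝ) : ℝ :=
  sInf {L | ∃ c : ℝ → Fin 4 → ℝ, ContDiffOn ℝ 1 c (Icc 0 1) ∧ (∀ s ∈ Icc (0 : ℝ) 1, 0 < c s 0) ∧
    c 0 = x ∧ c 1 = y ∧ L = curveLength c}

/-- On `[t₁, t₂]` the curve `γ` is `γ(t) = ξ(α t + β)` with `α ≥ 0` and `ξ` a geodesic parametrized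
by arc length, and the arc of `ξ` that `γ` runs through (its length is `α (t₂ - t₁)`) realizes
the distance between its end points. -/
def IsAffineMinimizingGeodesic (γ : ℝ → Fin 4 → ℝ) (t₁ t₂ α : ℝ) : Prop :=
  0 ≤ α ∧ (∃ (ξ : ℝ → Fin 4 → ℝ) (β : ℝ), IsUnitSpeedGeodesic ξ ∧
    ∀ t ∈ Icc t₁ t₂, γ t = ξ (α * t + β)) ∧
  hdist (γ t₁) (γ t₂) = α * (t₂ - t₁)

/-! ### The energy `∫ g_H(γ', γ') dt` -/

/-- The integrand `η'² / η² + (ω' + 2 χ ψ' - 2 ψ χ')² / η² + 4 (χ'² + ψ'²) / η`. -/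
def energyDensity (γ : ℝ → Fin 4 → ℝ) (t : ℝ) : ℝ :=
  gH (γ t) (deriv γ t) (deriv γ t)

/-- The energy of a curve on `[t₁, t₂]`. -/
def energy (t₁ t₂ : ℝ) (γ : ℝ → Fin 4 → ℝ) : ℝ :=
  ∫ t in t₁..t₂, energyDensity γ t

/-- The curves on which the energy is considered, with end points `p` and `q`: absolutely
continuous curves in `{η > 0}` of finite energy. -/
structure EnergyAdmissible (t₁ t₂ : ℝ) (p q : Fin 4 → ℝ) (γ : ℝ → Fin 4 → ℝ) : Prop where
  ac : ∀ k, AbsolutelyContinuousOnInterval (fun t => γ t k) t₁ t₂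
  pos : ∀ t ∈ Icc t₁ t₂, 0 < γ t 0
  finite : IntervalIntegrable (energyDensity γ) MeasureTheory.volume t₁ t₂
  left : γ t₁ = p
  right : γ t₂ = q

/-- `γ` minimizes the energy on `[t₁, t₂]` among the curves from `p` to `q`. -/
def IsEnergyMinimizer (t₁ t₂ : ℝ) (p q : Fin 4 → ℝ) (γ : ℝ → Fin 4 → ℝ) : Prop :=
  EnergyAdmissible t₁ t₂ p q γ ∧
    ∀ ζ, EnergyAdmissible t₁ t₂ p q ζ → energy t₁ t₂ γ ≤ energy t₁ t₂ ζ

/-! ### The functional `𝓜` on potentials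

A set of axisymmetric potentials is a function `D : ℝ → Fin 4 → ℝ` of the polar angle `θ`, with
`(D θ 0, D θ 1, D θ 2, D θ 3) = (σ, ω, ψ, χ)`. -/

/-- The squared norm `η = e^σ sin² θ`. -/
def etaOf (D : ℝ → Fin 4 → ℝ) (θ : ℝ) : ℝ := Real.exp (D θ 0) * Real.sin θ ^ 2

/-- The integrand
`(σ'² + 4 σ + (ω' + 2 χ ψ' - 2 ψ χ')² / η² + 4 (ψ'² + χ'²) / η) sin θ`. -/
def massDensity (D : ℝ → Fin 4 → ℝ) (θ : ℝ) : ℝ :=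
  (deriv D θ 0 ^ 2 + 4 * D θ 0
    + (deriv D θ 1 + 2 * D θ 3 * deriv D θ 2 - 2 * D θ 2 * deriv D θ 3) ^ 2 / etaOf D θ ^ 2
    + 4 * (deriv D θ 2 ^ 2 + deriv D θ 3 ^ 2) / etaOf D θ) * Real.sin θ

/-- The functional `𝓜_{θ₁,θ₂}`. -/
def mass (θ₁ θ₂ : ℝ) (D : ℝ → Fin 4 → ℝ) : ℝ :=
  ∫ θ in θ₁..θ₂, massDensity D θ

/-- The potentials on which `𝓜_{θ₁,θ₂}` is considered, with Dirichlet data `p` at `θ₁` and `q` at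
`θ₂`: absolutely continuous potentials on `[θ₁, θ₂]` for which the integral is finite. -/
structure MassAdmissible (θ₁ θ₂ : ℝ) (p q : Fin 4 → ℝ) (D : ℝ → Fin 4 → ℝ) : Prop where
  ac : ∀ k, AbsolutelyContinuousOnInterval (fun θ => D θ k) θ₁ θ₂
  finite : IntervalIntegrable (massDensity D) MeasureTheory.volume θ₁ θ₂
  left : D θ₁ = p
  right : D θ₂ = q

/-- `D` minimizes `𝓜_{θ₁,θ₂}` with Dirichlet data `p` at `θ₁` and `q` at `θ₂`. -/
def IsMassMinimizer (θ₁ θ₂ : ℝ) (p q : Fin 4 → ℝ) (D : ℝ → Fin 4 → ℝ) : Prop :=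
  MassAdmissible θ₁ θ₂ p q D ∧
    ∀ E, MassAdmissible θ₁ θ₂ p q E → mass θ₁ θ₂ D ≤ mass θ₁ θ₂ E

/-- The variable `t = ln tan (θ / 2)`. -/
def tOf (θ : ℝ) : ℝ := Real.log (Real.tan (θ / 2))

/-- Its inverse `θ = 2 arctan e^t`. -/
def thetaOf (t : ℝ) : ℝ := 2 * Real.arctan (Real.exp t)

/-- The curve `γ(t) = (η, ω, ψ, χ)(t)` in the complex hyperbolic plane given by potentials `D`. -/
def curveOf (D : ℝ → Fin 4 → ℝ) (t : ℝ) : Fin 4 → ℝ :=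
  ![etaOf D (thetaOf t), D (thetaOf t) 1, D (thetaOf t) 2, D (thetaOf t) 3]

/-! ### The explicit curves -/

/-- The constants in the explicit expressions. -/
structure Consts where
  c₁ : ℝ
  c₃ : ℝ
  c₄ : ℝ
  c₅ : ℝ
  α : ℝ

namespace Consts

/-- `c₁ ≠ 0`, `c₅ = 2 c₁ c₄`, `α > 0`. -/
def Valid (c : Consts) : Prop := c.c₁ ≠ 0 ∧ c.c₅ = 2 * c.c₁ * c.c₄ ∧ 0 < c.α

/-- `η = (c₅² / 2 + √(4 c₁² + c₅⁴) cosh (α t) / 2)⁻¹`. -/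
def eta (c : Consts) (t : ℝ) : ℝ :=
  (1 / 2 * c.c₅ ^ 2 + 1 / 2 * √(4 * c.c₁ ^ 2 + c.c₅ ^ 4) * Real.cosh (c.α * t))⁻¹

/-- `f = -2 arctan ((√(4 c₁² + c₅⁴) - c₅²) / (2 c₁) · tanh (α t / 2))`. -/
def f (c : Consts) (t : ℝ) : ℝ :=
  -2 * Real.arctan
    ((√(4 * c.c₁ ^ 2 + c.c₅ ^ 4) - c.c₅ ^ 2) / (2 * c.c₁) * Real.tanh (c.α * t / 2))

/-- The complex number `χ + i ψ = c₄ e^{i f} + c₃ / c₁`. -/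
def chiPsi (c : Consts) (t : ℝ) : ℂ :=
  c.c₄ * Complex.exp (Complex.I * (c.f t : ℂ)) + ((c.c₃ / c.c₁ : ℝ) : ℂ)

/-- `ω = (sgn t / c₁) √(1 - c₁² η² - 4 c₁² c₄² η) - 2 (c₃ / c₁) ψ`. -/
def omega (c : Consts) (t : ℝ) : ℝ :=
  Real.sign t / c.c₁ * √(1 - c.c₁ ^ 2 * c.eta t ^ 2 - 4 * c.c₁ ^ 2 * c.c₄ ^ 2 * c.eta t)
    - 2 * (c.c₃ / c.c₁) * (c.chiPsi t).im

/-- The curve `(η, ω, ψ, χ)(t)` with the constants `c`. -/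
def curve (c : Consts) (t : ℝ) : Fin 4 → ℝ :=
  ![c.eta t, c.omega t, (c.chiPsi t).im, (c.chiPsi t).re]

end Consts

end CH2

end

open CH2

/-!
The form `v₀ w̄₂ + v₂ w̄₀ - 2 v₁ w̄₁` on `ℂ³` identifies the complex hyperbolic plane with the set
of its positive lines, so that unitary maps act by isometries; they carry any two points to the
vertical line `s ↦ (e^s, 0, 0, 0)`. The function `b = log η` satisfies `|db| ≤ 1` everywhere and
`b = s` along this line, so it calibrates the line and, transported by isometries, all its images.
Hence these are geodesics and realize the distance, and by the Cauchy–Schwarz inequality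
`ξ (α τ + β)` is the unique minimizer of the energy `∫ w g_H(γ', γ') dx` for every positive weight
`w` with `dτ = dx / w`. Since `log tan (θ / 2)` has the derivative `1 / sin θ`, the functional `𝓜`
is the energy with weight `sin θ` up to boundary terms, which gives (1).

The explicit curve of (2) is the projection of `e^{αt/2} A + e^{-αt/2} B` for two null vectors `A`
and `B`, hence such a geodesic. The boundary conditions determine successively `η₁ sinh (α t₁)`,
`η₁ cosh (α t₁)`, `c₅`, `c₁` and `c₃`. In (3) these closed formulas converge, and the rate of
`α → 2` is read off from `α t = -arsinh (N / η)` at `θ = θⁱ`, where `N → 2 √(Q⁴ + 4 J²)` and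
`η = e^σ sin² θ → 0`.
-/

noncomputable section

namespace CH2

section HermitianModel

open Complex ComplexConjugate

/-! ### Isometries -/

/-- A smooth self-map of `{η > 0}` that preserves the metric `g_H`. -/
structure IsMetricMap (Φ : (Fin 4 → ℝ) → Fin 4 → ℝ) : Prop where
  smooth : ∀ x, 0 < x 0 → ContDiffAt ℝ ∞ Φ x
  pos : ∀ x, 0 < x 0 → 0 < Φ x 0
  metric : ∀ x v, 0 < x 0 → gH (Φ x) (fderiv ℝ Φ x v) (fderiv ℝ Φ x v) = gH x v v

/-- An isometry `Φ` of the complex hyperbolic plane together with its inverse `Ψ`. -/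
structure IsIsometryPair (Φ Ψ : (Fin 4 → ℝ) → Fin 4 → ℝ) : Prop where
  left : IsMetricMap Φ
  right : IsMetricMap Ψ
  left_inv : ∀ x, 0 < x 0 → Ψ (Φ x) = x
  right_inv : ∀ x, 0 < x 0 → Φ (Ψ x) = x

/-! ### The Hermitian model -/

/-- The Hermitian form `v₀ w̄₂ + v₂ w̄₀ - 2 v₁ w̄₁` of signature `(1, 2)` on `ℂ³`. Its positive
lines are the points of the complex hyperbolic plane. -/
def herm (v w : Fin 3 → ℂ) : ℂ :=
  v 0 * conj (w 2) + v 2 * conj (w 0) - 2 * v 1 * conj (w 1)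

/-- The representative with last entry `1` of the positive line that corresponds to the point
`(η, ω, ψ, χ)`. -/
def lift (x : Fin 4 → ℝ) : Fin 3 → ℂ :=
  ![x 0 + x 2 ^ 2 + x 3 ^ 2 - x 1 * I, x 3 + x 2 * I, 1]

/-- The point that corresponds to the line through `v`; a junk value if `v 2 = 0`. -/
def proj (v : Fin 3 → ℂ) : Fin 4 → ℝ :=
  ![(v 0 / v 2).re - normSq (v 1 / v 2), -(v 0 / v 2).im, (v 1 / v 2).im, (v 1 / v 2).re]

/-- The derivative of `lift` at `x` in the direction `u`. -/
def dlift (x u : Fin 4 → ℝ) : Fin 3 → ℂ :=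
  ![u 0 + 2 * x 2 * u 2 + 2 * x 3 * u 3 - u 1 * I, u 3 + u 2 * I, 0]

/-- The squared speed, in the Fubini–Study type metric of the form `herm`, of a curve of positive
lines that is represented by `V` and moves with velocity `V'`. -/
def hermSpeed (V V' : Fin 3 → ℂ) : ℝ :=
  4 * (normSq (herm V' V) - (herm V V).re * (herm V' V').re) / (herm V V).re ^ 2

theorem herm_add_left (u v w : Fin 3 → ℂ) : herm (u + v) w = herm u w + herm v w := by
  simp only [herm, Pi.add_apply]
  ring

theorem herm_smul_left (c : ℂ) (v w : Fin 3 → ℂ) : herm (c • v) w = c * herm v w := by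
  simp only [herm, Pi.smul_apply, smul_eq_mul]
  ring

theorem conj_herm (v w : Fin 3 → ℂ) : conj (herm v w) = herm w v := by
  simp only [herm, map_add, map_sub, map_mul, conj_conj, map_ofNat]
  ring

theorem herm_add_right (u v w : Fin 3 → ℂ) : herm u (v + w) = herm u v + herm u w := by
  rw [← conj_herm, herm_add_left, map_add, conj_herm, conj_herm]

theorem herm_smul_right (c : ℂ) (v w : Fin 3 → ℂ) : herm v (c • w) = conj c * herm v w := by
  rw [← conj_herm, herm_smul_left, map_mul, conj_herm]

theorem herm_self_im (v : Fin 3 → ℂ) : (herm v v).im = 0 :=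
  conj_eq_iff_im.1 (conj_herm v v)

theorem herm_self_eq_re (v : Fin 3 → ℂ) : herm v v = (herm v v).re :=
  Complex.ext rfl (herm_self_im v)

theorem proj_smul {c : ℂ} (hc : c ≠ 0) (v : Fin 3 → ℂ) : proj (c • v) = proj v := by
  simp only [proj, Pi.smul_apply, smul_eq_mul, mul_div_mul_left _ _ hc]

theorem proj_lift (x : Fin 4 → ℝ) : proj (lift x) = x := by
  ext k
  fin_cases k <;> simp [proj, lift, normSq_apply, ← ofReal_pow]
  ring

theorem lift_proj (v : Fin 3 → ℂ) : lift (proj v) = ![v 0 / v 2, v 1 / v 2, 1] := by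
  simp only [lift, proj]
  generalize v 0 / v 2 = U
  generalize v 1 / v 2 = z
  ext k
  fin_cases k <;> simp [Complex.ext_iff, normSq_apply, ← ofReal_pow]
  ring

theorem smul_lift_proj {v : Fin 3 → ℂ} (hv : v 2 ≠ 0) : v 2 • lift (proj v) = v := by
  rw [lift_proj]
  ext k
  fin_cases k
  exacts [mul_div_cancel₀ (v 0) hv, mul_div_cancel₀ (v 1) hv, mul_one (v 2)]

theorem herm_lift_self (x : Fin 4 → ℝ) : herm (lift x) (lift x) = 2 * x 0 := by
  simp [herm, lift, Complex.ext_iff, ← ofReal_pow]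
  constructor <;> ring

theorem herm_self_eq_proj {v : Fin 3 → ℂ} (hv : v 2 ≠ 0) :
    (herm v v).re = 2 * normSq (v 2) * proj v 0 := by
  nth_rw 1 2 [← smul_lift_proj hv]
  rw [herm_smul_left, herm_smul_right, herm_lift_self, ← mul_assoc, mul_conj]
  simp only [mul_re, ofReal_re, ofReal_im, re_ofNat, im_ofNat]
  ring

theorem ne_zero_of_herm_pos {v : Fin 3 → ℂ} (hv : 0 < (herm v v).re) : v 2 ≠ 0 := by
  intro h
  simp only [herm, h, map_zero, mul_zero, zero_mul, zero_add, zero_sub, mul_assoc, mul_conj,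
    neg_re, mul_re, re_ofNat, im_ofNat, ofReal_re, ofReal_im, sub_zero] at hv
  linarith [normSq_nonneg (v 1)]

theorem proj_pos {v : Fin 3 → ℂ} (hv : 0 < (herm v v).re) : 0 < proj v 0 := by
  rw [herm_self_eq_proj (ne_zero_of_herm_pos hv)] at hv
  exact pos_of_mul_pos_right hv (by positivity [normSq_nonneg (v 2)])

theorem herm_lift_pos {x : Fin 4 → ℝ} (hx : 0 < x 0) : 0 < (herm (lift x) (lift x)).re := by
  simpa [herm_lift_self] using hx

theorem gH_eq_hermSpeed {x : Fin 4 → ℝ} (hx : 0 < x 0) (v : Fin 4 → ℝ) :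
    gH x v v = hermSpeed (lift x) (dlift x v) := by
  have := hx.ne'
  simp only [hermSpeed, herm_lift_self]
  simp [herm, lift, dlift, gH, contactForm, normSq_apply, ← ofReal_pow]
  field_simp
  ring

theorem herm_smul_smul_self_re (c : ℂ) (V : Fin 3 → ℂ) :
    (herm (c • V) (c • V)).re = normSq c * (herm V V).re := by
  rw [herm_smul_left, herm_smul_right, ← mul_assoc, mul_conj, re_ofReal_mul]

theorem hermSpeed_smul_add {c : ℂ} (hc : c ≠ 0) (c' : ℂ) (V V' : Fin 3 → ℂ) :
    hermSpeed (c • V) (c' • V + c • V') = hermSpeed V V' := by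
  have hgram : normSq (herm (c' • V + c • V') (c • V))
      - normSq c * (herm V V).re * (herm (c' • V + c • V') (c' • V + c • V')).re
        = normSq c ^ 2 * (normSq (herm V' V) - (herm V V).re * (herm V' V').re) := by
    have hVV := herm_self_eq_re V
    have hVV' := herm_self_eq_re V'
    simp only [herm_add_left, herm_add_right, herm_smul_left, herm_smul_right, ← conj_herm V' V]
    rw [hVV, hVV']
    simp [normSq_apply]
    ring
  have hc' : normSq c ^ 2 ≠ 0 := pow_ne_zero 2 (normSq_eq_zero.not.2 hc)
  rw [hermSpeed, herm_smul_smul_self_re, hgram, mul_pow, mul_left_comm, mul_div_mul_left _ _ hc',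
    hermSpeed]

theorem contDiff_lift : ContDiff ℝ ∞ lift := by
  refine contDiff_pi.2 fun k => ?_
  have h (i : Fin 4) : ContDiff ℝ ∞ fun x : Fin 4 → ℝ => (x i : ℂ) :=
    ofRealCLM.contDiff.comp (contDiff_apply ℝ ℝ i)
  fin_cases k
  · exact (((h 0).add ((h 2).pow 2)).add ((h 3).pow 2)).sub ((h 1).mul contDiff_const)
  · exact (h 3).add ((h 2).mul contDiff_const)
  · exact contDiff_const

theorem hasDerivAt_lift {x : ℝ → Fin 4 → ℝ} {u : Fin 4 → ℝ} {t : ℝ} (h : HasDerivAt x u t) :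
    HasDerivAt (fun t => lift (x t)) (dlift (x t) u) t := by
  have hx (i : Fin 4) : HasDerivAt (fun t => (x t i : ℂ)) (u i) t :=
    (hasDerivAt_pi.1 h i).ofReal_comp
  refine hasDerivAt_pi.2 fun k => ?_
  fin_cases k
  · refine ((((hx 0).fun_add ((hx 2).fun_pow 2)).fun_add ((hx 3).fun_pow 2)).fun_sub
      ((hx 1).mul_const I)).congr_deriv ?_
    simp [dlift]
  · exact (hx 3).fun_add ((hx 2).mul_const I)
  · exact hasDerivAt_const t 1

/-- A linear automorphism of `ℂ³` that preserves the form `herm`. -/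
def IsUnitary (A : (Fin 3 → ℂ) ≃ₗ[ℂ] (Fin 3 → ℂ)) : Prop :=
  ∀ v w, herm (A v) (A w) = herm v w

/-- The action of a linear automorphism of `ℂ³` on the points of the complex hyperbolic plane. -/
def act (A : (Fin 3 → ℂ) ≃ₗ[ℂ] (Fin 3 → ℂ)) (x : Fin 4 → ℝ) : Fin 4 → ℝ := proj (A (lift x))

variable {A : (Fin 3 → ℂ) ≃ₗ[ℂ] (Fin 3 → ℂ)}

theorem IsUnitary.symm (hA : IsUnitary A) : IsUnitary A.symm := fun v w => by
  rw [← hA, A.apply_symm_apply, A.apply_symm_apply]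

theorem IsUnitary.herm_lift_pos (hA : IsUnitary A) {x : Fin 4 → ℝ} (hx : 0 < x 0) :
    0 < (herm (A (lift x)) (A (lift x))).re := by
  rw [hA]
  exact CH2.herm_lift_pos hx

theorem IsUnitary.act_symm_act (hA : IsUnitary A) {x : Fin 4 → ℝ} (hx : 0 < x 0) :
    act A.symm (act A x) = x := by
  have h := ne_zero_of_herm_pos (hA.herm_lift_pos hx)
  rw [act, ← proj_smul h, ← map_smul, act, smul_lift_proj h, A.symm_apply_apply, proj_lift]

theorem IsUnitary.contDiffAt_act (hA : IsUnitary A) {x : Fin 4 → ℝ} (hx : 0 < x 0) :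
    ContDiffAt ℝ ∞ (act A) x := by
  have h₂ := ne_zero_of_herm_pos (hA.herm_lift_pos hx)
  have hAl (k : Fin 3) : ContDiffAt ℝ ∞ (fun x => A (lift x) k) x :=
    contDiff_pi.1 ((A.toContinuousLinearEquiv.toContinuousLinearMap.restrictScalars ℝ).contDiff.comp
      contDiff_lift) k |>.contDiffAt
  have hquot (k : Fin 3) : ContDiffAt ℝ ∞ (fun x => A (lift x) k / A (lift x) 2) x :=
    ((hAl k).mul ((hAl 2).inv h₂)).congr_of_eventuallyEq
      (Eventually.of_forall fun _ => div_eq_mul_inv _ _)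
  have hre (k : Fin 3) := reCLM.contDiff.contDiffAt.comp x (hquot k)
  have him (k : Fin 3) := imCLM.contDiff.contDiffAt.comp x (hquot k)
  refine contDiffAt_pi.2 fun k => ?_
  fin_cases k
  exacts [(hre 0).sub (((hre 1).mul (hre 1)).add ((him 1).mul (him 1))), (him 0).neg, him 1, hre 1]

theorem hasDerivAt_add_smul {E : Type*} [NormedAddCommGroup E] [NormedSpace ℝ E] (x v : E) :
    HasDerivAt (fun t : ℝ => x + t • v) v 0 := by
  simpa using ((hasDerivAt_id (0 : ℝ)).smul_const v).const_add x

theorem eventually_add_smul_pos {x : Fin 4 → ℝ} (hx : 0 < x 0) (v : Fin 4 → ℝ) :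
    ∀ᶠ t in 𝓝 (0 : ℝ), 0 < (x + t • v) 0 :=
  (show ContinuousAt (fun t : ℝ => (x + t • v) 0) 0 by fun_prop).eventually
    (lt_mem_nhds (by simpa using hx))

theorem IsUnitary.gH_fderiv_act (hA : IsUnitary A) {x : Fin 4 → ℝ} (hx : 0 < x 0)
    (v : Fin 4 → ℝ) :
    gH (act A x) (fderiv ℝ (act A) x v) (fderiv ℝ (act A) x v) = gH x v v := by
  have hW₂ := ne_zero_of_herm_pos (hA.herm_lift_pos hx)
  have hx₀ : x + (0 : ℝ) • v = x := by simp
  have hact : HasDerivAt (fun t : ℝ => act A (x + t • v)) (fderiv ℝ (act A) x v) 0 :=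
    ((hA.contDiffAt_act hx).differentiableAt (by simp)).hasFDerivAt.comp_hasDerivAt_of_eq (0 : ℝ)
      (hasDerivAt_add_smul x v) hx₀.symm
  have hW : HasDerivAt (fun t : ℝ => A (lift (x + t • v))) (A (dlift x v)) 0 := by
    have h := (A.toContinuousLinearEquiv.toContinuousLinearMap.restrictScalars
      ℝ).hasFDerivAt.comp_hasDerivAt (0 : ℝ) (hasDerivAt_lift (hasDerivAt_add_smul x v))
    rwa [hx₀] at h
  have hsmul : HasDerivAt (fun t : ℝ => A (lift (x + t • v)))
      (A (dlift x v) 2 • lift (act A x)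
        + A (lift x) 2 • dlift (act A x) (fderiv ℝ (act A) x v)) 0 := by
    have h := (hasDerivAt_pi.1 hW 2).fun_smul (hasDerivAt_lift hact)
    rw [hx₀, add_comm] at h
    refine h.congr_of_eventuallyEq ?_
    filter_upwards [eventually_add_smul_pos hx v] with t ht
    exact (smul_lift_proj (ne_zero_of_herm_pos (hA.herm_lift_pos ht))).symm
  calc gH (act A x) (fderiv ℝ (act A) x v) (fderiv ℝ (act A) x v)
      = hermSpeed (A (lift x)) (A (dlift x v)) := by
        rw [gH_eq_hermSpeed (x := act A x) (proj_pos (hA.herm_lift_pos hx)), hW.unique hsmul,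
          ← hermSpeed_smul_add hW₂ (A (dlift x v) 2),
          show A (lift x) 2 • lift (act A x) = A (lift x) from smul_lift_proj hW₂]
    _ = hermSpeed (lift x) (dlift x v) := by
        rw [hermSpeed, hA, hA, hA, hermSpeed]
    _ = gH x v v := (gH_eq_hermSpeed hx v).symm

theorem IsUnitary.isMetricMap_act (hA : IsUnitary A) : IsMetricMap (act A) where
  smooth _ hx := hA.contDiffAt_act hx
  pos _ hx := proj_pos (hA.herm_lift_pos hx)
  metric _ v hx := hA.gH_fderiv_act hx v

theorem IsUnitary.isIsometryPair_act (hA : IsUnitary A) : IsIsometryPair (act A) (act A.symm) where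
  left := hA.isMetricMap_act
  right := hA.symm.isMetricMap_act
  left_inv _ hx := hA.act_symm_act hx
  right_inv _ hx := by simpa using hA.symm.act_symm_act hx

/-! ### Geodesic lines -/

/-- The vertical geodesic `s ↦ (e^s, 0, 0, 0)`. -/
def vert (s : ℝ) : Fin 4 → ℝ := ![Real.exp s, 0, 0, 0]

/-- The images of the vertical geodesic under isometries. Up to the choice of the parameter these
are all geodesics of the complex hyperbolic plane, because its isometry group is transitive on unit
tangent vectors. -/
def IsGeodesicLine (ξ : ℝ → Fin 4 → ℝ) : Prop :=
  ∃ Φ Ψ, IsIsometryPair Φ Ψ ∧ ∀ s, ξ s = Φ (vert s)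

/-- The vector product of `ℂ³` that is adapted to the form `herm`: it is orthogonal to both
factors. -/
def hermCross (a b : Fin 3 → ℂ) : Fin 3 → ℂ :=
  star ![2 * (a 0 * b 1 - a 1 * b 0), a 0 * b 2 - a 2 * b 0, 2 * (a 1 * b 2 - a 2 * b 1)]

theorem herm_hermCross_left (a b : Fin 3 → ℂ) : herm a (hermCross a b) = 0 := by
  simp [herm, hermCross, map_ofNat]
  ring

theorem herm_hermCross_right (a b : Fin 3 → ℂ) : herm b (hermCross a b) = 0 := by
  simp [herm, hermCross, map_ofNat]
  ring

theorem herm_hermCross_self (a b : Fin 3 → ℂ) :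
    herm (hermCross a b) (hermCross a b)
      = -2 * (herm a b * herm b a - herm a a * herm b b) := by
  simp [herm, hermCross, map_ofNat]
  ring

theorem eq_zero_of_forall_herm_eq_zero {v : Fin 3 → ℂ} (hv : ∀ w, herm v w = 0) : v = 0 := by
  ext k
  fin_cases k
  exacts [by simpa [herm] using hv (Pi.single 2 1), by simpa [herm] using hv (Pi.single 1 1),
    by simpa [herm] using hv (Pi.single 0 1)]

/-- The linear map that sends the standard basis to `a`, `hermCross a b`, `b`. -/
def frameMap (a b : Fin 3 → ℂ) : (Fin 3 → ℂ) →ₗ[ℂ] (Fin 3 → ℂ) :=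
  Fintype.linearCombination ℂ ![a, hermCross a b, b]

theorem frameMap_apply (a b v : Fin 3 → ℂ) :
    frameMap a b v = v 0 • a + v 1 • hermCross a b + v 2 • b := by
  simp [frameMap, Fintype.linearCombination_apply, Fin.sum_univ_three]

variable {a b : Fin 3 → ℂ}

theorem herm_frameMap (ha : herm a a = 0) (hb : herm b b = 0) (hab : herm a b = 1)
    (v w : Fin 3 → ℂ) : herm (frameMap a b v) (frameMap a b w) = herm v w := by
  have hba : herm b a = 1 := by rw [← conj_herm, hab, map_one]
  have hae := herm_hermCross_left a b
  have hbe := herm_hermCross_right a b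
  have hea : herm (hermCross a b) a = 0 := by rw [← conj_herm, hae, map_zero]
  have heb : herm (hermCross a b) b = 0 := by rw [← conj_herm, hbe, map_zero]
  simp only [frameMap_apply, herm_add_left, herm_add_right, herm_smul_left, herm_smul_right, ha, hb,
    hab, hba, hae, hbe, hea, heb, herm_hermCross_self]
  rw [herm]
  ring

theorem exists_isUnitary (ha : herm a a = 0) (hb : herm b b = 0) (hab : herm a b = 1) :
    ∃ A : (Fin 3 → ℂ) ≃ₗ[ℂ] (Fin 3 → ℂ), IsUnitary A ∧ ∀ v, A v = frameMap a b v := by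
  have hinj : Function.Injective (frameMap a b) := by
    refine (injective_iff_map_eq_zero _).2 fun v hv => eq_zero_of_forall_herm_eq_zero fun w => ?_
    rw [← herm_frameMap ha hb hab, hv]
    simp [herm]
  exact ⟨LinearEquiv.ofInjectiveEndo _ hinj, herm_frameMap ha hb hab, fun _ => rfl⟩

theorem isGeodesicLine_proj_of_herm_eq_one (ha : herm a a = 0) (hb : herm b b = 0)
    (hab : herm a b = 1) :
    IsGeodesicLine fun s => proj ((Real.exp (s / 2) : ℂ) • a + (Real.exp (-(s / 2)) : ℂ) • b) := by
  obtain ⟨A, hA, hAv⟩ := exists_isUnitary ha hb hab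
  refine ⟨act A, act A.symm, hA.isIsometryPair_act, fun s => ?_⟩
  have hlift : A (lift (vert s)) = (Real.exp s : ℂ) • a + b := by
    simp [hAv, frameMap_apply, lift, vert]
  have hexp : Real.exp (-(s / 2)) * Real.exp s = Real.exp (s / 2) := by
    rw [← Real.exp_add]
    ring_nf
  rw [act, hlift, ← proj_smul (ofReal_ne_zero.2 (Real.exp_pos (-(s / 2))).ne'), smul_add, smul_smul,
    ← ofReal_mul, hexp]

theorem isGeodesicLine_proj (ha : herm a a = 0) (hb : herm b b = 0) {m : ℝ} (hm : 0 < m)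
    (hab : herm a b = m) :
    IsGeodesicLine fun s => proj ((Real.exp (s / 2) : ℂ) • a + (Real.exp (-(s / 2)) : ℂ) • b) := by
  have hμ : ((√m)⁻¹ : ℂ) ≠ 0 := inv_ne_zero (ofReal_ne_zero.2 (Real.sqrt_pos.2 hm).ne')
  have hmm : ((√m)⁻¹ : ℝ) * (((√m)⁻¹ : ℝ) * m : ℂ) = 1 := by
    rw [← ofReal_mul, ← ofReal_mul, ← mul_assoc, ← mul_inv, Real.mul_self_sqrt hm.le,
      inv_mul_cancel₀ hm.ne', ofReal_one]
  have h := isGeodesicLine_proj_of_herm_eq_one (a := ((√m)⁻¹ : ℂ) • a) (b := ((√m)⁻¹ : ℂ) • b)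
    (by rw [herm_smul_left, herm_smul_right, ha, mul_zero, mul_zero])
    (by rw [herm_smul_left, herm_smul_right, hb, mul_zero, mul_zero])
    (by rw [herm_smul_left, herm_smul_right, hab, ← ofReal_inv, conj_ofReal, hmm])
  simpa only [smul_comm _ ((√m)⁻¹ : ℂ), ← smul_add, proj_smul hμ] using h

theorem four_mul_lt_normSq_herm_lift {p q : Fin 4 → ℝ} (hp : 0 < p 0) (hq : 0 < q 0) (hpq : p ≠ q) :
    4 * (p 0 * q 0) < normSq (herm (lift q) (lift p)) := by
  have hgram : normSq (herm (lift q) (lift p)) - 4 * (p 0 * q 0)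
      = (q 0 - p 0) ^ 2 + ((q 2 - p 2) ^ 2 + (q 3 - p 3) ^ 2) ^ 2
        + 2 * ((q 2 - p 2) ^ 2 + (q 3 - p 3) ^ 2) * (q 0 + p 0)
        + (q 1 - p 1 + 2 * (q 2 * p 3 - q 3 * p 2)) ^ 2 := by
    simp [herm, lift, normSq_apply, ← ofReal_pow]
    ring
  rw [← sub_pos, hgram]
  contrapose! hpq
  have hd : 0 ≤ (q 2 - p 2) ^ 2 + (q 3 - p 3) ^ 2 := by positivity
  have hcross := mul_nonneg (mul_nonneg zero_le_two hd) (add_pos hq hp).le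
  have h₀ : q 0 - p 0 = 0 := by
    refine sq_eq_zero_iff.1 (le_antisymm ?_ (sq_nonneg _))
    linarith [sq_nonneg ((q 2 - p 2) ^ 2 + (q 3 - p 3) ^ 2),
      sq_nonneg (q 1 - p 1 + 2 * (q 2 * p 3 - q 3 * p 2))]
  have hz : (q 2 - p 2) ^ 2 + (q 3 - p 3) ^ 2 = 0 := by
    refine sq_eq_zero_iff.1 (le_antisymm ?_ (sq_nonneg _))
    linarith [sq_nonneg (q 0 - p 0), sq_nonneg (q 1 - p 1 + 2 * (q 2 * p 3 - q 3 * p 2))]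
  have h₂ : q 2 - p 2 = 0 := by nlinarith [sq_nonneg (q 2 - p 2), sq_nonneg (q 3 - p 3)]
  have h₃ : q 3 - p 3 = 0 := by nlinarith [sq_nonneg (q 2 - p 2), sq_nonneg (q 3 - p 3)]
  have h₁ : q 1 - p 1 + 2 * (q 2 * p 3 - q 3 * p 2) = 0 := by
    refine sq_eq_zero_iff.1 (le_antisymm ?_ (sq_nonneg _))
    linarith [sq_nonneg (q 0 - p 0), sq_nonneg ((q 2 - p 2) ^ 2 + (q 3 - p 3) ^ 2)]
  have h₁' : p 1 = q 1 := by linear_combination 2 * p 3 * h₂ - 2 * p 2 * h₃ - h₁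
  ext k
  fin_cases k
  exacts [(sub_eq_zero.1 h₀).symm, h₁', (sub_eq_zero.1 h₂).symm, (sub_eq_zero.1 h₃).symm]

theorem exists_isGeodesicLine_of_herm_eq_cosh {P Q : Fin 3 → ℂ} (hP : herm P P = 2)
    (hQ : herm Q Q = 2) {σ : ℝ} (hσ : 0 < σ) (hQP : herm Q P = (2 * Real.cosh σ : ℝ)) :
    ∃ ξ, IsGeodesicLine ξ ∧ ξ 0 = proj P ∧ ξ (2 * σ) = proj Q := by
  have hPQ : herm P Q = (2 * Real.cosh σ : ℝ) := by rw [← conj_herm, hQP, conj_ofReal]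
  have hsinh : 2 * Real.sinh σ ≠ 0 := (mul_pos two_pos (Real.sinh_pos_iff.2 hσ)).ne'
  have hcosh : (2 * Real.cosh σ : ℝ) = (Real.exp σ + Real.exp (-σ) : ℂ) := by
    rw [Real.cosh_eq]; push_cast; ring
  have hdiff : (2 * Real.sinh σ : ℝ) = (Real.exp σ - Real.exp (-σ) : ℂ) := by
    rw [Real.sinh_eq]; push_cast; ring
  have hmul : (Real.exp σ : ℂ) * Real.exp (-σ) = 1 := by
    rw [← ofReal_mul, ← Real.exp_add]; simp
  rw [hcosh] at hPQ hQP
  set a : Fin 3 → ℂ := Q + (-Real.exp (-σ) : ℂ) • P with ha_def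
  set b : Fin 3 → ℂ := (Real.exp σ : ℂ) • P + (-1 : ℂ) • Q with hb_def
  have ha : herm a a = 0 := by
    simp only [ha_def, herm_add_left, herm_add_right, herm_smul_left, herm_smul_right, hP, hQ, hPQ,
      hQP, map_neg, conj_ofReal]
    linear_combination -2 * hmul
  have hb : herm b b = 0 := by
    simp only [hb_def, herm_add_left, herm_add_right, herm_smul_left, herm_smul_right, hP, hQ, hPQ,
      hQP, map_neg, map_one, conj_ofReal]
    linear_combination -2 * hmul
  have hab : herm a b = ((2 * Real.sinh σ) ^ 2 : ℝ) := by
    rw [ofReal_pow, hdiff]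
    simp only [ha_def, hb_def, herm_add_left, herm_add_right, herm_smul_left, herm_smul_right, hP,
      hQ, hPQ, hQP, map_neg, map_one, conj_ofReal]
    linear_combination 2 * hmul
  refine ⟨_, isGeodesicLine_proj ha hb (by positivity) hab, ?_, ?_⟩
  · have h : a + b = ((2 * Real.sinh σ : ℝ) : ℂ) • P := by
      rw [ha_def, hb_def, hdiff]
      module
    simp only [zero_div, neg_zero, Real.exp_zero, ofReal_one, one_smul]
    rw [h, proj_smul (ofReal_ne_zero.2 hsinh)]
  · have h : (Real.exp σ : ℂ) • a + (Real.exp (-σ) : ℂ) • b = ((2 * Real.sinh σ : ℝ) : ℂ) • Q := by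
      rw [ha_def, hb_def, hdiff]
      module
    simp only [mul_div_cancel_left₀ σ two_ne_zero]
    rw [h, proj_smul (ofReal_ne_zero.2 hsinh)]

/-- The representative of the point `x` on which the form `herm` takes the value `2`. -/
def unitLift (x : Fin 4 → ℝ) : Fin 3 → ℂ := ((√(x 0))⁻¹ : ℂ) • lift x

theorem herm_unitLift_self {x : Fin 4 → ℝ} (hx : 0 < x 0) :
    herm (unitLift x) (unitLift x) = 2 := by
  have h : (√(x 0) : ℂ) * √(x 0) = x 0 := by rw [← ofReal_mul, Real.mul_self_sqrt hx.le]
  have h₀ : (√(x 0) : ℂ) ≠ 0 := ofReal_ne_zero.2 (Real.sqrt_pos.2 hx).ne'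
  rw [unitLift, herm_smul_left, herm_smul_right, herm_lift_self, ← h, map_inv₀, conj_ofReal]
  field_simp

theorem proj_unitLift {x : Fin 4 → ℝ} (hx : 0 < x 0) : proj (unitLift x) = x := by
  rw [unitLift, proj_smul (inv_ne_zero (ofReal_ne_zero.2 (Real.sqrt_pos.2 hx).ne')), proj_lift]

theorem two_lt_norm_herm_unitLift {p q : Fin 4 → ℝ} (hp : 0 < p 0) (hq : 0 < q 0) (hpq : p ≠ q) :
    2 < ‖herm (unitLift q) (unitLift p)‖ := by
  have h := four_mul_lt_normSq_herm_lift hp hq hpq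
  refine lt_of_pow_lt_pow_left₀ 2 (norm_nonneg _) ?_
  rw [unitLift, unitLift, herm_smul_left, herm_smul_right, norm_mul, norm_mul, mul_pow, mul_pow,
    ← normSq_eq_norm_sq (herm _ _), RCLike.norm_conj, norm_inv, norm_inv, norm_real, norm_real,
    Real.norm_of_nonneg (Real.sqrt_nonneg _), Real.norm_of_nonneg (Real.sqrt_nonneg _), inv_pow,
    inv_pow, Real.sq_sqrt hp.le, Real.sq_sqrt hq.le]
  field_simp
  linarith

theorem exists_isGeodesicLine_of_ne {p q : Fin 4 → ℝ} (hp : 0 < p 0) (hq : 0 < q 0) (hpq : p ≠ q) :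
    ∃ ξ s₁ s₂, IsGeodesicLine ξ ∧ s₁ < s₂ ∧ ξ s₁ = p ∧ ξ s₂ = q := by
  set z := herm (unitLift q) (unitLift p) with hz_def
  have hz : 2 < ‖z‖ := two_lt_norm_herm_unitLift hp hq hpq
  have hz₀ : (‖z‖ : ℂ) ≠ 0 := ofReal_ne_zero.2 (by linarith)
  have hzz : z * conj z = ‖z‖ * ‖z‖ := by rw [mul_conj, normSq_eq_norm_sq]; push_cast; ring
  -- The phase that makes the product of the two representatives positive.
  set u : ℂ := conj z / ‖z‖ with hu_def
  have hu : u * conj u = 1 := by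
    rw [hu_def, map_div₀, conj_conj, conj_ofReal, div_mul_div_comm, mul_comm, hzz,
      div_self (mul_ne_zero hz₀ hz₀)]
  have huz : u * z = ‖z‖ := by
    rw [hu_def, div_mul_eq_mul_div, mul_comm, hzz, mul_div_cancel_right₀ _ hz₀]
  have hu₀ : u ≠ 0 := left_ne_zero_of_mul_eq_one hu
  obtain ⟨ξ, hξ, hξp, hξq⟩ := exists_isGeodesicLine_of_herm_eq_cosh (P := unitLift p)
    (Q := u • unitLift q) (σ := Real.arcosh (‖z‖ / 2)) (herm_unitLift_self hp)
    (by rw [herm_smul_left, herm_smul_right, herm_unitLift_self hq, ← mul_assoc, hu, one_mul])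
    (Real.arcosh_pos (by linarith))
    (by rw [herm_smul_left, ← hz_def, huz, Real.cosh_arcosh (by linarith),
      mul_div_cancel₀ _ two_ne_zero])
  refine ⟨ξ, 0, _, hξ, mul_pos two_pos (Real.arcosh_pos (by linarith)), ?_, hξq.trans ?_⟩
  · rw [hξp, proj_unitLift hp]
  · rw [proj_smul hu₀, proj_unitLift hq]

theorem exists_isGeodesicLine {p q : Fin 4 → ℝ} (hp : 0 < p 0) (hq : 0 < q 0) :
    ∃ ξ s₁ s₂, IsGeodesicLine ξ ∧ s₁ ≤ s₂ ∧ ξ s₁ = p ∧ ξ s₂ = q := by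
  by_cases hpq : p = q
  · have hne : p ≠ Function.update p 0 (2 * p 0) := fun h => by
      have := congrFun h 0
      rw [Function.update_self] at this
      linarith
    obtain ⟨ξ, s, -, hξ, -, hs, -⟩ := exists_isGeodesicLine_of_ne hp (by simpa using hp) hne
    exact ⟨ξ, s, s, hξ, le_rfl, hs, hs.trans hpq⟩
  · obtain ⟨ξ, s₁, s₂, hξ, hs, h₁, h₂⟩ := exists_isGeodesicLine_of_ne hp hq hpq
    exact ⟨ξ, s₁, s₂, hξ, hs.le, h₁, h₂⟩

end HermitianModel

/-! ### Calibrated curves are geodesics -/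

theorem gH_comm (x v w : Fin 4 → ℝ) : gH x v w = gH x w v := by
  unfold gH
  ring

theorem gH_add_smul (x v w : Fin 4 → ℝ) (ε : ℝ) :
    gH x (v + ε • w) (v + ε • w) = gH x v v + 2 * ε * gH x v w + ε ^ 2 * gH x w w := by
  simp only [gH, contactForm, Pi.add_apply, Pi.smul_apply, smul_eq_mul]
  ring

theorem gH_smul_smul (x v : Fin 4 → ℝ) (c : ℝ) : gH x (c • v) (c • v) = c ^ 2 * gH x v v := by
  simp only [gH, contactForm, Pi.smul_apply, smul_eq_mul]
  ring

theorem gH_eq_sum (x v w : Fin 4 → ℝ) : gH x v w = ∑ i, ∑ j, v i * w j * gComp i j x := by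
  simp [Fin.sum_univ_four, gComp, gH, contactForm, coordVec, Pi.single_apply]
  ring

theorem gH_coordVec (x v : Fin 4 → ℝ) (k : Fin 4) :
    gH x v (coordVec k) = ∑ i, v i * gComp i k x := by
  simp [gH_eq_sum, coordVec, Pi.single_apply]

theorem differentiableAt_gComp (i j : Fin 4) {x : Fin 4 → ℝ} (hx : 0 < x 0) :
    DifferentiableAt ℝ (gComp i j) x := by
  have h₁ : x 0 ≠ 0 := hx.ne'
  have h₂ : x 0 ^ 2 ≠ 0 := pow_ne_zero 2 h₁
  unfold gComp gH contactForm
  fun_prop (disch := assumption)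

/-- A smooth function on the complex hyperbolic plane whose differential has norm at most one. -/
structure IsCalibration (b : (Fin 4 → ℝ) → ℝ) : Prop where
  contDiffAt : ∀ x, 0 < x 0 → ContDiffAt ℝ ∞ b x
  sq_le : ∀ x v, 0 < x 0 → fderiv ℝ b x v ^ 2 ≤ gH x v v

namespace IsCalibration

variable {b : (Fin 4 → ℝ) → ℝ} {x v : Fin 4 → ℝ}

theorem hasFDerivAt_fderiv (hb : IsCalibration b) (hx : 0 < x 0) :
    HasFDerivAt (fderiv ℝ b) (fderiv ℝ (fderiv ℝ b) x) x :=
  (((hb.contDiffAt x hx).fderiv_right (m := ∞) (by simp)).differentiableAt (by simp)).hasFDerivAt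

theorem isSymmSndFDerivAt (hb : IsCalibration b) (hx : 0 < x 0) : IsSymmSndFDerivAt ℝ b x :=
  (hb.contDiffAt x hx).isSymmSndFDerivAt (by
    simpa using WithTop.coe_le_coe.2 (le_top : (2 : ℕ∞) ≤ ⊤))

theorem gH_eq_fderiv (hb : IsCalibration b) (hx : 0 < x 0) (hv : gH x v v = 1)
    (hbv : fderiv ℝ b x v = 1) (w : Fin 4 → ℝ) : gH x v w = fderiv ℝ b x w := by
  have hquad (ε : ℝ) : 0 ≤ (gH x w w - fderiv ℝ b x w ^ 2) * (ε * ε)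
      + 2 * (gH x v w - fderiv ℝ b x w) * ε + 0 := by
    have h := hb.sq_le x (v + ε • w) hx
    rw [gH_add_smul, hv, map_add, map_smul, hbv, smul_eq_mul] at h
    linarith
  have h := discrim_le_zero hquad
  rw [discrim, mul_zero, sub_zero] at h
  linarith [sq_eq_zero_iff.1 (le_antisymm h (sq_nonneg _))]

/-- At `x` the nonnegative function `y ↦ g_y(v, v) - db_y(v)²` has a minimum. -/
theorem sum_fderiv_gComp (hb : IsCalibration b) (hx : 0 < x 0) (hv : gH x v v = 1)
    (hbv : fderiv ℝ b x v = 1) (w : Fin 4 → ℝ) :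
    ∑ i, ∑ j, v i * v j * fderiv ℝ (gComp i j) x w = 2 * fderiv ℝ (fderiv ℝ b) x w v := by
  have hx₀ : x + (0 : ℝ) • w = x := by simp
  have hline := hasDerivAt_add_smul x w
  have hg : HasDerivAt (fun ε : ℝ => gH (x + ε • w) v v)
      (∑ i, ∑ j, v i * v j * fderiv ℝ (gComp i j) x w) 0 := by
    simp only [gH_eq_sum]
    exact HasDerivAt.fun_sum fun i _ => HasDerivAt.fun_sum fun j _ =>
      ((differentiableAt_gComp i j hx).hasFDerivAt.comp_hasDerivAt_of_eq (0 : ℝ) hline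
        hx₀.symm).const_mul (v i * v j)
  have hdb : HasDerivAt (fun ε : ℝ => fderiv ℝ b (x + ε • w) v)
      (fderiv ℝ (fderiv ℝ b) x w v) 0 := by
    simpa using ((hb.hasFDerivAt_fderiv hx).comp_hasDerivAt_of_eq (0 : ℝ) hline
      hx₀.symm).clm_apply (hasDerivAt_const (0 : ℝ) v)
  have hmin : IsLocalMin (fun ε : ℝ => gH (x + ε • w) v v - fderiv ℝ b (x + ε • w) v ^ 2) 0 := by
    filter_upwards [eventually_add_smul_pos hx w] with ε hε
    rw [hx₀, hv, hbv, one_pow, sub_self, sub_nonneg]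
    exact hb.sq_le _ v hε
  have h := hmin.hasDerivAt_eq_zero (hg.fun_sub (hdb.fun_pow 2))
  rw [hx₀, hbv] at h
  norm_num at h
  linarith

variable {ξ : ℝ → Fin 4 → ℝ}

/-- The derivative of the identity `g(ξ', ∂ₖ) = db(∂ₖ)` along a calibrated curve. -/
theorem sum_deriv_deriv_mul_gComp (hb : IsCalibration b) (hξ : ContDiff ℝ ∞ ξ)
    (hpos : ∀ s, 0 < ξ s 0) (hunit : ∀ s, gH (ξ s) (deriv ξ s) (deriv ξ s) = 1)
    (hbξ : ∀ s, fderiv ℝ b (ξ s) (deriv ξ s) = 1) (s : ℝ) (k : Fin 4) :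
    ∑ i, (deriv (deriv ξ) s i * gComp i k (ξ s)
        + deriv ξ s i * fderiv ℝ (gComp i k) (ξ s) (deriv ξ s))
      = fderiv ℝ (fderiv ℝ b) (ξ s) (deriv ξ s) (coordVec k) := by
  have hξ' : HasDerivAt ξ (deriv ξ s) s := (hξ.differentiable (by simp) s).hasDerivAt
  have hξ'' : HasDerivAt (deriv ξ) (deriv (deriv ξ) s) s :=
    ((contDiff_infty_iff_deriv.1 hξ).2.differentiable (by simp) s).hasDerivAt
  have hg : HasDerivAt (fun s => gH (ξ s) (deriv ξ s) (coordVec k))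
      (∑ i, (deriv (deriv ξ) s i * gComp i k (ξ s)
        + deriv ξ s i * fderiv ℝ (gComp i k) (ξ s) (deriv ξ s))) s := by
    simp only [gH_coordVec]
    exact HasDerivAt.fun_sum fun i _ => (hasDerivAt_pi.1 hξ'' i).fun_mul
      ((differentiableAt_gComp i k (hpos s)).hasFDerivAt.comp_hasDerivAt s hξ')
  have hdb : HasDerivAt (fun s => fderiv ℝ b (ξ s) (coordVec k))
      (fderiv ℝ (fderiv ℝ b) (ξ s) (deriv ξ s) (coordVec k)) s := by
    simpa using ((hb.hasFDerivAt_fderiv (hpos s)).comp_hasDerivAt s hξ').clm_apply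
      (hasDerivAt_const s (coordVec k))
  refine hg.unique (hdb.congr_of_eventuallyEq (Eventually.of_forall fun s => ?_))
  exact hb.gH_eq_fderiv (hpos s) (hunit s) (hbξ s) _

theorem fderiv_eq_sum (F : (Fin 4 → ℝ) → ℝ) (x v : Fin 4 → ℝ) :
    fderiv ℝ F x v = ∑ l, v l * partialD l F x := by
  have hv : v = ∑ l, v l • coordVec l := by
    simp only [coordVec, ← Pi.single_smul, smul_eq_mul, mul_one, Finset.univ_sum_single]
  conv_lhs => rw [hv]
  simp only [map_sum, map_smul, smul_eq_mul, partialD]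

theorem isUnitSpeedGeodesic (hb : IsCalibration b) (hξ : ContDiff ℝ ∞ ξ)
    (hpos : ∀ s, 0 < ξ s 0) (hunit : ∀ s, gH (ξ s) (deriv ξ s) (deriv ξ s) = 1)
    (hbξ : ∀ s, fderiv ℝ b (ξ s) (deriv ξ s) = 1) : IsUnitSpeedGeodesic ξ := by
  refine ⟨hξ, hpos, hunit, fun s k => ?_⟩
  have hnext := hb.sum_deriv_deriv_mul_gComp hξ hpos hunit hbξ s k
  have hmin : ∑ i, ∑ j, deriv ξ s i * deriv ξ s j * partialD k (gComp i j) (ξ s)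
      = 2 * fderiv ℝ (fderiv ℝ b) (ξ s) (coordVec k) (deriv ξ s) :=
    hb.sum_fderiv_gComp (hpos s) (hunit s) (hbξ s) (coordVec k)
  rw [hb.isSymmSndFDerivAt (hpos s)] at hnext
  have hswap : ∑ j, gComp k j (ξ s) * deriv (deriv ξ) s j
      = ∑ j, deriv (deriv ξ) s j * gComp j k (ξ s) :=
    Finset.sum_congr rfl fun j _ => by rw [gComp, gH_comm, mul_comm, gComp]
  rw [hswap]
  simp only [fderiv_eq_sum _ (ξ s) (deriv ξ s)] at hnext
  simp only [christoffel, Fin.sum_univ_four] at hnext hmin ⊢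
  linear_combination hnext - hmin / 2

end IsCalibration

theorem sq_le_gH {x : Fin 4 → ℝ} (hx : 0 < x 0) (v : Fin 4 → ℝ) : (v 0 / x 0) ^ 2 ≤ gH x v v := by
  have h : gH x v v
      = (v 0 / x 0) ^ 2 + ((contactForm x v / x 0) ^ 2 + 4 * (v 3 ^ 2 + v 2 ^ 2) / x 0) := by
    rw [gH]
    ring
  rw [h]
  exact le_add_of_nonneg_right (by positivity)

theorem vert_pos (s : ℝ) : 0 < vert s 0 := Real.exp_pos s

theorem contDiff_vert : ContDiff ℝ ∞ vert :=
  contDiff_pi.2 fun k => by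
    fin_cases k
    exacts [Real.contDiff_exp, contDiff_const, contDiff_const, contDiff_const]

theorem hasDerivAt_vert (s : ℝ) : HasDerivAt vert (vert s) s :=
  hasDerivAt_pi.2 fun k => by
    fin_cases k
    exacts [Real.hasDerivAt_exp s, hasDerivAt_const s 0, hasDerivAt_const s 0, hasDerivAt_const s 0]

theorem gH_vert (s : ℝ) : gH (vert s) (vert s) (vert s) = 1 := by
  simp [gH, vert, contactForm, ← pow_two]

variable {Φ Ψ : (Fin 4 → ℝ) → Fin 4 → ℝ}

theorem IsMetricMap.hasFDerivAt (h : IsMetricMap Φ) {x : Fin 4 → ℝ} (hx : 0 < x 0) :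
    HasFDerivAt Φ (fderiv ℝ Φ x) x :=
  ((h.smooth x hx).differentiableAt (by simp)).hasFDerivAt

theorem IsMetricMap.hasDerivAt_comp_vert (h : IsMetricMap Φ) (s : ℝ) :
    HasDerivAt (fun s => Φ (vert s)) (fderiv ℝ Φ (vert s) (vert s)) s :=
  (h.hasFDerivAt (vert_pos s)).comp_hasDerivAt s (hasDerivAt_vert s)

theorem IsMetricMap.hasFDerivAt_log (h : IsMetricMap Φ) {x : Fin 4 → ℝ} (hx : 0 < x 0) :
    HasFDerivAt (fun x => Real.log (Φ x 0))
      ((Φ x 0)⁻¹ • (ContinuousLinearMap.proj (R := ℝ) (φ := fun _ : Fin 4 => ℝ) 0).comp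
        (fderiv ℝ Φ x)) x :=
  (hasFDerivAt_pi'.1 (h.hasFDerivAt hx) 0).log (h.pos x hx).ne'

theorem IsMetricMap.isCalibration_log (h : IsMetricMap Φ) :
    IsCalibration fun x => Real.log (Φ x 0) where
  contDiffAt x hx := (contDiffAt_pi.1 (h.smooth x hx) 0).log (h.pos x hx).ne'
  sq_le x v hx := by
    rw [(h.hasFDerivAt_log hx).fderiv, ← h.metric x v hx]
    convert sq_le_gH (h.pos x hx) (fderiv ℝ Φ x v) using 2
    simp [div_eq_inv_mul]

theorem IsIsometryPair.isUnitSpeedGeodesic (h : IsIsometryPair Φ Ψ) :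
    IsUnitSpeedGeodesic fun s => Φ (vert s) := by
  have hderiv (s : ℝ) : deriv (fun s => Φ (vert s)) s = fderiv ℝ Φ (vert s) (vert s) :=
    (h.left.hasDerivAt_comp_vert s).deriv
  refine h.right.isCalibration_log.isUnitSpeedGeodesic
    (contDiff_iff_contDiffAt.2 fun s =>
      (h.left.smooth _ (vert_pos s)).comp s contDiff_vert.contDiffAt)
    (fun s => h.left.pos _ (vert_pos s)) (fun s => ?_) (fun s => ?_)
  · rw [hderiv, h.left.metric _ _ (vert_pos s), gH_vert]
  · have hlog : (fun s => Real.log (Ψ (Φ (vert s)) 0)) = id :=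
      funext fun s => by rw [h.left_inv _ (vert_pos s)]; exact Real.log_exp s
    have hcomp := (h.right.isCalibration_log.contDiffAt _
      (h.left.pos _ (vert_pos s))).differentiableAt (by simp) |>.hasFDerivAt.comp_hasDerivAt s
      (h.left.hasDerivAt_comp_vert s)
    rw [hderiv]
    exact hcomp.unique ((hasDerivAt_id s).congr_of_eventuallyEq (.of_forall (congrFun hlog)))

theorem IsGeodesicLine.isUnitSpeedGeodesic {ξ : ℝ → Fin 4 → ℝ} (hξ : IsGeodesicLine ξ) :
    IsUnitSpeedGeodesic ξ := by
  obtain ⟨Φ, Ψ, h, hξΦ⟩ := hξ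
  exact funext hξΦ ▸ h.isUnitSpeedGeodesic

section Variational

open MeasureTheory

/-! ### The weighted energy -/

theorem absolutelyContinuousOnInterval_pi {ι : Type*} [Fintype ι] {ζ : ℝ → ι → ℝ} {a b : ℝ}
    (h : ∀ k, AbsolutelyContinuousOnInterval (fun x => ζ x k) a b) :
    AbsolutelyContinuousOnInterval ζ a b := by
  refine squeeze_zero (fun E => Finset.sum_nonneg fun i _ => dist_nonneg) (fun E => ?_)
    (by simpa using tendsto_finsetSum Finset.univ fun k _ => h k)
  rw [Finset.sum_comm]
  refine Finset.sum_le_sum fun i _ => (dist_pi_le_iff ?_).2 fun k => ?_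
  · exact Finset.sum_nonneg fun _ _ => dist_nonneg
  · exact Finset.single_le_sum (f := fun k => dist (ζ (E.2 i).1 k) (ζ (E.2 i).2 k))
      (fun _ _ => dist_nonneg) (Finset.mem_univ k)

theorem absolutelyContinuousOnInterval_comp_of_locallyLipschitzOn {X Y : Type*}
    [SeminormedAddCommGroup X] [PseudoMetricSpace Y] {F : X → Y} {ζ : ℝ → X} {a b : ℝ}
    (hF : LocallyLipschitzOn (ζ '' uIcc a b) F) (hζ : AbsolutelyContinuousOnInterval ζ a b) :
    AbsolutelyContinuousOnInterval (fun x => F (ζ x)) a b := by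
  have hcompact : IsCompact (ζ '' uIcc a b) :=
    isCompact_uIcc.image_of_continuousOn hζ.continuousOn
  obtain ⟨K, hK⟩ := LocallyLipschitzOn.exists_lipschitzOnWith_of_compact hcompact hF
  have hlim := Tendsto.const_mul (K : ℝ) hζ
  rw [mul_zero] at hlim
  refine squeeze_zero' (Eventually.of_forall fun E => Finset.sum_nonneg fun i _ => dist_nonneg) ?_
    hlim
  rw [AbsolutelyContinuousOnInterval.totalLengthFilter, eventually_inf_principal]
  refine Eventually.of_forall fun E hE => ?_
  rw [Finset.mul_sum]
  exact Finset.sum_le_sum fun i hi => hK.dist_le_mul _ (mem_image_of_mem ζ (hE.1 i hi).1)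
    _ (mem_image_of_mem ζ (hE.1 i hi).2)

theorem absolutelyContinuousOnInterval_comp_of_contDiffAt {E F : Type*} [NormedAddCommGroup E]
    [NormedSpace ℝ E] [NormedAddCommGroup F] [NormedSpace ℝ F] {Φ : E → F} {ζ : ℝ → E} {a b : ℝ}
    (hΦ : ∀ x ∈ uIcc a b, ContDiffAt ℝ 1 Φ (ζ x)) (hζ : AbsolutelyContinuousOnInterval ζ a b) :
    AbsolutelyContinuousOnInterval (fun x => Φ (ζ x)) a b := by
  refine absolutelyContinuousOnInterval_comp_of_locallyLipschitzOn ?_ hζ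
  rintro _ ⟨x, hx, rfl⟩
  obtain ⟨K, t, ht, hK⟩ := (hΦ x hx).exists_lipschitzOnWith
  exact ⟨K, t, mem_nhdsWithin_of_mem_nhds ht, hK⟩

theorem absolutelyContinuousOnInterval_apply {ι : Type*} [Fintype ι] {ζ : ℝ → ι → ℝ} {a b : ℝ}
    (hζ : AbsolutelyContinuousOnInterval ζ a b) (k : ι) :
    AbsolutelyContinuousOnInterval (fun x => ζ x k) a b :=
  absolutelyContinuousOnInterval_comp_of_contDiffAt (Φ := fun x : ι → ℝ => x k)
    (fun _ _ => (contDiff_apply ℝ ℝ k).contDiffAt) hζ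

theorem ae_differentiableAt_of_absolutelyContinuousOnInterval {ι : Type*} [Fintype ι]
    {ζ : ℝ → ι → ℝ} {a b : ℝ} (hζ : AbsolutelyContinuousOnInterval ζ a b) :
    ∀ᵐ x, x ∈ uIcc a b → DifferentiableAt ℝ ζ x := by
  filter_upwards [ae_all_iff.2 fun k =>
    (absolutelyContinuousOnInterval_apply hζ k).ae_differentiableAt] with x hx hxm
  exact differentiableAt_pi.2 fun k => hx k hxm

theorem ae_mem_Ioo_of_mem_uIcc {a b : ℝ} (hab : a ≤ b) :
    ∀ᵐ x : ℝ, x ∈ uIcc a b → x ∈ Ioo a b := by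
  filter_upwards [Ioo_ae_eq_Icc (a := a) (b := b) (μ := volume)] with x hx hxm
  rw [uIcc_of_le hab] at hxm
  exact hx.mpr hxm

theorem ae_restrict_uIoc_of_ae {a b : ℝ} {P : ℝ → Prop} (h : ∀ᵐ x, x ∈ uIcc a b → P x) :
    ∀ᵐ x ∂volume.restrict (uIoc a b), P x :=
  (ae_restrict_iff' measurableSet_uIoc).2 (h.mono fun _ hx hxm => hx (uIoc_subset_uIcc hxm))

/-- A positive weight `w` on `[a, b]` together with a time `τ` satisfying `dτ = dx / w`, in which
the weighted energy `∫ w g_H(ζ', ζ') dx` becomes the energy. The potentials use the clock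
`(sin, ln tan (θ / 2))`. -/
structure IsClock (w τ : ℝ → ℝ) (a b : ℝ) : Prop where
  lt : a < b
  pos : ∀ x ∈ Icc a b, 0 < w x
  contDiffOn : ContDiffOn ℝ ∞ τ (Icc a b)
  hasDerivAt : ∀ x ∈ Ioo a b, HasDerivAt τ (1 / w x) x

/-- The energy of `ζ` on `[a, b]` with weight `w`. -/
def weightedEnergy (w : ℝ → ℝ) (a b : ℝ) (ζ : ℝ → Fin 4 → ℝ) : ℝ :=
  ∫ x in a..b, w x * energyDensity ζ x

/-- An absolutely continuous curve in `{η > 0}` with finite weighted energy. -/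
structure HasFiniteEnergy (w : ℝ → ℝ) (a b : ℝ) (ζ : ℝ → Fin 4 → ℝ) : Prop where
  ac : AbsolutelyContinuousOnInterval ζ a b
  pos : ∀ x ∈ uIcc a b, 0 < ζ x 0
  finite : IntervalIntegrable (fun x => w x * energyDensity ζ x) volume a b

section WeightedEnergy

variable {w τ : ℝ → ℝ} {a b α β : ℝ} {ζ y : ℝ → Fin 4 → ℝ}

theorem IsClock.absolutelyContinuousOnInterval (hτ : IsClock w τ a b) :
    AbsolutelyContinuousOnInterval τ a b :=
  ContDiffOn.absolutelyContinuousOnInterval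
    (uIcc_of_le hτ.lt.le ▸ hτ.contDiffOn.of_le (by simp))

section MetricMap

variable {Φ Ψ : (Fin 4 → ℝ) → Fin 4 → ℝ}

theorem IsMetricMap.hasDerivAt_comp (h : IsMetricMap Φ) {x : ℝ} (hζ : DifferentiableAt ℝ ζ x)
    (hpos : 0 < ζ x 0) :
    HasDerivAt (fun x => Φ (ζ x)) (fderiv ℝ Φ (ζ x) (deriv ζ x)) x :=
  (h.hasFDerivAt hpos).comp_hasDerivAt x hζ.hasDerivAt

theorem IsMetricMap.energyDensity_comp (h : IsMetricMap Φ) {x : ℝ}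
    (hζ : DifferentiableAt ℝ ζ x) (hpos : 0 < ζ x 0) :
    energyDensity (fun x => Φ (ζ x)) x = energyDensity ζ x := by
  rw [energyDensity, (h.hasDerivAt_comp hζ hpos).deriv, h.metric _ _ hpos, energyDensity]

theorem IsMetricMap.mul_energyDensity_comp_ae (h : IsMetricMap Φ) (hζ : HasFiniteEnergy w a b ζ) :
    (fun x => w x * energyDensity (fun x => Φ (ζ x)) x)
      =ᵐ[volume.restrict (uIoc a b)] fun x => w x * energyDensity ζ x := by
  refine ae_restrict_uIoc_of_ae ?_
  filter_upwards [ae_differentiableAt_of_absolutelyContinuousOnInterval hζ.ac] with x hx hxm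
  rw [h.energyDensity_comp (hx hxm) (hζ.pos x hxm)]

theorem IsMetricMap.hasFiniteEnergy_comp (h : IsMetricMap Φ) (hζ : HasFiniteEnergy w a b ζ) :
    HasFiniteEnergy w a b fun x => Φ (ζ x) where
  ac := absolutelyContinuousOnInterval_comp_of_contDiffAt
    (fun x hx => (h.smooth _ (hζ.pos x hx)).of_le (by simp)) hζ.ac
  pos x hx := h.pos _ (hζ.pos x hx)
  finite := hζ.finite.congr_ae (h.mul_energyDensity_comp_ae hζ).symm

theorem IsMetricMap.weightedEnergy_comp (h : IsMetricMap Φ) (hζ : HasFiniteEnergy w a b ζ) :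
    weightedEnergy w a b (fun x => Φ (ζ x)) = weightedEnergy w a b ζ :=
  intervalIntegral.integral_congr_ae_restrict (h.mul_energyDensity_comp_ae hζ)

end MetricMap

theorem mul_gH_sub_eq {x : Fin 4 → ℝ} (hx : 0 < x 0) (v : Fin 4 → ℝ) {c : ℝ} (hc : 0 < c) :
    c * gH x v v - 2 * α * (v 0 / x 0) + α ^ 2 * (1 / c)
      = c * ((v 0 / x 0 - α / c) ^ 2 + (contactForm x v / x 0) ^ 2
        + 4 * (v 3 ^ 2 + v 2 ^ 2) / x 0) := by
  have := hx.ne'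
  unfold gH
  field_simp
  ring

theorem mul_gH_sub_nonneg {x : Fin 4 → ℝ} (hx : 0 < x 0) (v : Fin 4 → ℝ) {c : ℝ} (hc : 0 < c) :
    0 ≤ c * gH x v v - 2 * α * (v 0 / x 0) + α ^ 2 * (1 / c) := by
  rw [mul_gH_sub_eq hx v hc]
  positivity

theorem eq_of_mul_gH_sub_eq_zero {x v : Fin 4 → ℝ} (hx : 0 < x 0) {c : ℝ} (hc : 0 < c)
    (h : c * gH x v v - 2 * α * (v 0 / x 0) + α ^ 2 * (1 / c) = 0) :
    v 0 / x 0 = α / c ∧ v 1 = 0 ∧ v 2 = 0 ∧ v 3 = 0 := by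
  rw [mul_gH_sub_eq hx v hc, mul_eq_zero, or_iff_right hc.ne',
    add_eq_zero_iff_of_nonneg (by positivity) (by positivity),
    add_eq_zero_iff_of_nonneg (by positivity) (by positivity),
    sq_eq_zero_iff, sq_eq_zero_iff, sub_eq_zero, div_eq_zero_iff, div_eq_zero_iff,
    or_iff_left hx.ne', or_iff_left hx.ne', mul_eq_zero, or_iff_right four_ne_zero,
    add_eq_zero_iff_of_nonneg (by positivity) (by positivity), sq_eq_zero_iff, sq_eq_zero_iff] at h
  obtain ⟨⟨h₀, h₁⟩, h₃, h₂⟩ := h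
  rw [contactForm, h₂, h₃, mul_zero, mul_zero, add_zero, sub_zero] at h₁
  exact ⟨h₀, h₁, h₂, h₃⟩

/-- The amount by which the weighted energy density of `y` exceeds its lower bound
`2 α (ln η)' - α² τ'`, with equality along `vert (α τ + β)`. -/
def energyExcess (w τ : ℝ → ℝ) (α : ℝ) (y : ℝ → Fin 4 → ℝ) (x : ℝ) : ℝ :=
  w x * energyDensity y x - 2 * α * deriv (fun x => Real.log (y x 0)) x + α ^ 2 * deriv τ x

theorem energyExcess_eq (hτ : IsClock w τ a b) {x : ℝ} (hx : x ∈ Ioo a b)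
    (hy : DifferentiableAt ℝ y x) (hpos : 0 < y x 0) :
    energyExcess w τ α y x = w x * gH (y x) (deriv y x) (deriv y x)
      - 2 * α * (deriv y x 0 / y x 0) + α ^ 2 * (1 / w x) := by
  rw [energyExcess, ((hasDerivAt_pi.1 hy.hasDerivAt 0).log hpos.ne').deriv,
    (hτ.hasDerivAt x hx).deriv, energyDensity]

theorem HasFiniteEnergy.absolutelyContinuousOnInterval_log (hy : HasFiniteEnergy w a b y) :
    AbsolutelyContinuousOnInterval (fun x => Real.log (y x 0)) a b :=
  absolutelyContinuousOnInterval_comp_of_contDiffAt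
    (fun x hx => Real.contDiffAt_log.2 (hy.pos x hx).ne')
    (absolutelyContinuousOnInterval_apply hy.ac 0)

theorem intervalIntegrable_energyExcess (hτ : IsClock w τ a b) (hy : HasFiniteEnergy w a b y) :
    IntervalIntegrable (energyExcess w τ α y) volume a b :=
  (hy.finite.sub (hy.absolutelyContinuousOnInterval_log.intervalIntegrable_deriv.const_mul _)).add
    (hτ.absolutelyContinuousOnInterval.intervalIntegrable_deriv.const_mul _)

theorem integral_energyExcess (hτ : IsClock w τ a b) (hy : HasFiniteEnergy w a b y) :
    ∫ x in a..b, energyExcess w τ α y x = weightedEnergy w a b y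
      - 2 * α * (Real.log (y b 0) - Real.log (y a 0)) + α ^ 2 * (τ b - τ a) := by
  have hlog := hy.absolutelyContinuousOnInterval_log
  have hlog' := hlog.intervalIntegrable_deriv.const_mul (2 * α)
  have hτ' := hτ.absolutelyContinuousOnInterval.intervalIntegrable_deriv.const_mul (α ^ 2)
  simp only [energyExcess]
  rw [intervalIntegral.integral_add (hy.finite.sub hlog') hτ',
    intervalIntegral.integral_sub hy.finite hlog', intervalIntegral.integral_const_mul,
    intervalIntegral.integral_const_mul, hlog.integral_deriv_eq_sub,
    hτ.absolutelyContinuousOnInterval.integral_deriv_eq_sub, weightedEnergy]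

theorem energyExcess_ae_eq (hτ : IsClock w τ a b) (hy : HasFiniteEnergy w a b y) :
    ∀ᵐ x, x ∈ uIcc a b → x ∈ Ioo a b ∧ DifferentiableAt ℝ y x ∧
      energyExcess w τ α y x = w x * gH (y x) (deriv y x) (deriv y x)
        - 2 * α * (deriv y x 0 / y x 0) + α ^ 2 * (1 / w x) := by
  filter_upwards [ae_differentiableAt_of_absolutelyContinuousOnInterval hy.ac,
    ae_mem_Ioo_of_mem_uIcc hτ.lt.le] with x hx hxI hxm
  exact ⟨hxI hxm, hx hxm, energyExcess_eq hτ (hxI hxm) (hx hxm) (hy.pos x hxm)⟩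

theorem energyExcess_nonneg_ae (hτ : IsClock w τ a b) (hy : HasFiniteEnergy w a b y) :
    0 ≤ᵐ[volume.restrict (Ioc a b)] energyExcess w τ α y := by
  rw [← uIoc_of_le hτ.lt.le]
  refine ae_restrict_uIoc_of_ae ?_
  filter_upwards [energyExcess_ae_eq hτ hy] with x hx hxm
  obtain ⟨hxI, -, hexc⟩ := hx hxm
  rw [Pi.zero_apply, hexc]
  exact mul_gH_sub_nonneg (hy.pos x hxm) _ (hτ.pos x (Ioo_subset_Icc_self hxI))

theorem weightedEnergy_lower_bound (hτ : IsClock w τ a b) (hy : HasFiniteEnergy w a b y) :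
    2 * α * (Real.log (y b 0) - Real.log (y a 0)) - α ^ 2 * (τ b - τ a)
      ≤ weightedEnergy w a b y := by
  have h : 0 ≤ ∫ x in a..b, energyExcess w τ α y x := by
    rw [intervalIntegral.integral_of_le hτ.lt.le]
    exact integral_nonneg_of_ae (energyExcess_nonneg_ae hτ hy)
  rw [integral_energyExcess hτ hy] at h
  linarith

theorem ae_hasDerivAt_of_weightedEnergy_le (hτ : IsClock w τ a b) (hy : HasFiniteEnergy w a b y)
    (hle : weightedEnergy w a b y
      ≤ 2 * α * (Real.log (y b 0) - Real.log (y a 0)) - α ^ 2 * (τ b - τ a)) :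
    ∀ᵐ x, x ∈ uIcc a b → HasDerivAt (fun x => Real.log (y x 0) - α * τ x) 0 x ∧
      HasDerivAt (fun x => y x 1) 0 x ∧ HasDerivAt (fun x => y x 2) 0 x ∧
      HasDerivAt (fun x => y x 3) 0 x := by
  have hzero : ∫ x in a..b, energyExcess w τ α y x = 0 := by
    rw [integral_energyExcess hτ hy]
    linarith [weightedEnergy_lower_bound (α := α) hτ hy]
  rw [intervalIntegral.integral_eq_zero_iff_of_le_of_nonneg_ae hτ.lt.le
    (energyExcess_nonneg_ae hτ hy) (intervalIntegrable_energyExcess hτ hy), EventuallyEq,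
    ae_restrict_iff' measurableSet_Ioc] at hzero
  filter_upwards [hzero, energyExcess_ae_eq (α := α) hτ hy] with x hx₀ hx hxm
  obtain ⟨hxI, hd, hexc⟩ := hx hxm
  have hpos := hy.pos x hxm
  obtain ⟨h₀, h₁, h₂, h₃⟩ := eq_of_mul_gH_sub_eq_zero hpos (hτ.pos x (Ioo_subset_Icc_self hxI))
    (hexc.symm.trans (hx₀ (Ioo_subset_Ioc_self hxI)))
  have hk (k : Fin 4) := hasDerivAt_pi.1 hd.hasDerivAt k
  refine ⟨?_, h₁ ▸ hk 1, h₂ ▸ hk 2, h₃ ▸ hk 3⟩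
  have hlog := ((hk 0).log hpos.ne').fun_sub ((hτ.hasDerivAt x hxI).const_mul α)
  rwa [h₀, mul_one_div, sub_self] at hlog

theorem eq_left_of_ae_hasDerivAt_zero {f : ℝ → ℝ} (hf : AbsolutelyContinuousOnInterval f a b)
    (hf' : ∀ᵐ x, x ∈ uIcc a b → HasDerivAt f 0 x) {x : ℝ} (hx : x ∈ uIcc a b) : f x = f a := by
  obtain ⟨C, hC⟩ := hf.const_of_ae_hasDerivAt_zero hf'
  rw [hC x hx, hC a left_mem_uIcc]

theorem eqOn_vert_of_weightedEnergy_le (hτ : IsClock w τ a b) (hy : HasFiniteEnergy w a b y)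
    (ha : y a = vert (α * τ a + β)) (hb : y b = vert (α * τ b + β))
    (hle : weightedEnergy w a b y ≤ α ^ 2 * (τ b - τ a)) :
    EqOn y (fun x => vert (α * τ x + β)) (uIcc a b) := by
  have hlog (s : ℝ) : Real.log (vert s 0) = s := Real.log_exp s
  have hderiv := ae_hasDerivAt_of_weightedEnergy_le (α := α) hτ hy
    (by rw [ha, hb, hlog, hlog]; linarith)
  have hac := absolutelyContinuousOnInterval_apply hy.ac
  intro x hx
  have h₀ := eq_left_of_ae_hasDerivAt_zero
    (hy.absolutelyContinuousOnInterval_log.fun_sub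
      (hτ.absolutelyContinuousOnInterval.const_mul α)) (hderiv.mono fun x hx hxm => (hx hxm).1) hx
  have h₁ := eq_left_of_ae_hasDerivAt_zero (hac 1) (hderiv.mono fun x hx hxm => (hx hxm).2.1) hx
  have h₂ := eq_left_of_ae_hasDerivAt_zero (hac 2) (hderiv.mono fun x hx hxm => (hx hxm).2.2.1) hx
  have h₃ := eq_left_of_ae_hasDerivAt_zero (hac 3) (hderiv.mono fun x hx hxm => (hx hxm).2.2.2) hx
  simp only [ha, hlog] at h₀ h₁ h₂ h₃
  ext k
  fin_cases k
  · rw [Fin.zero_eta, ← Real.exp_log (hy.pos x hx), show Real.log (y x 0) = α * τ x + β by linarith]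
    rfl
  exacts [h₁, h₂, h₃]

theorem hasDerivAt_vert_clock (hτ : IsClock w τ a b) {x : ℝ} (hx : x ∈ Ioo a b) :
    HasDerivAt (fun x => vert (α * τ x + β)) ((α * (1 / w x)) • vert (α * τ x + β)) x :=
  (hasDerivAt_vert _).scomp x (((hτ.hasDerivAt x hx).const_mul α).add_const β)

theorem mul_energyDensity_vert_clock (hτ : IsClock w τ a b) {x : ℝ} (hx : x ∈ Ioo a b) :
    w x * energyDensity (fun x => vert (α * τ x + β)) x = α ^ 2 * deriv τ x := by
  have := (hτ.pos x (Ioo_subset_Icc_self hx)).ne'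
  rw [energyDensity, (hasDerivAt_vert_clock hτ hx).deriv, gH_smul_smul, gH_vert,
    (hτ.hasDerivAt x hx).deriv]
  field_simp

theorem mul_energyDensity_vert_clock_ae (hτ : IsClock w τ a b) :
    (fun x => w x * energyDensity (fun x => vert (α * τ x + β)) x)
      =ᵐ[volume.restrict (uIoc a b)] fun x => α ^ 2 * deriv τ x :=
  ae_restrict_uIoc_of_ae ((ae_mem_Ioo_of_mem_uIcc hτ.lt.le).mono fun _ hx hxm =>
    mul_energyDensity_vert_clock hτ (hx hxm))

theorem hasFiniteEnergy_vert_clock (hτ : IsClock w τ a b) :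
    HasFiniteEnergy w a b fun x => vert (α * τ x + β) where
  ac := absolutelyContinuousOnInterval_comp_of_contDiffAt (Φ := fun t : ℝ => vert (α * t + β))
    (fun _ _ => ((contDiff_vert.of_le (by simp)).comp
      (f := fun t : ℝ => α * t + β) (by fun_prop)).contDiffAt) hτ.absolutelyContinuousOnInterval
  pos _ _ := vert_pos _
  finite := (hτ.absolutelyContinuousOnInterval.intervalIntegrable_deriv.const_mul _).congr_ae
    (mul_energyDensity_vert_clock_ae hτ).symm

theorem weightedEnergy_vert_clock (hτ : IsClock w τ a b) :
    weightedEnergy w a b (fun x => vert (α * τ x + β)) = α ^ 2 * (τ b - τ a) := by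
  rw [weightedEnergy, intervalIntegral.integral_congr_ae_restrict
    (mul_energyDensity_vert_clock_ae hτ), intervalIntegral.integral_const_mul,
    hτ.absolutelyContinuousOnInterval.integral_deriv_eq_sub]

namespace IsGeodesicLine

variable {ξ : ℝ → Fin 4 → ℝ}

theorem hasFiniteEnergy (hξ : IsGeodesicLine ξ) (hτ : IsClock w τ a b) :
    HasFiniteEnergy w a b fun x => ξ (α * τ x + β) := by
  obtain ⟨Φ, Ψ, h, hξΦ⟩ := hξ
  simpa only [hξΦ] using h.left.hasFiniteEnergy_comp (hasFiniteEnergy_vert_clock hτ)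

theorem weightedEnergy_eq (hξ : IsGeodesicLine ξ) (hτ : IsClock w τ a b) :
    weightedEnergy w a b (fun x => ξ (α * τ x + β)) = α ^ 2 * (τ b - τ a) := by
  obtain ⟨Φ, Ψ, h, hξΦ⟩ := hξ
  simp only [hξΦ]
  rw [h.left.weightedEnergy_comp (hasFiniteEnergy_vert_clock hτ), weightedEnergy_vert_clock hτ]

theorem weightedEnergy_le (hξ : IsGeodesicLine ξ) (hτ : IsClock w τ a b)
    (hζ : HasFiniteEnergy w a b ζ) (ha : ζ a = ξ (α * τ a + β)) (hb : ζ b = ξ (α * τ b + β)) :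
    weightedEnergy w a b (fun x => ξ (α * τ x + β)) ≤ weightedEnergy w a b ζ := by
  rw [hξ.weightedEnergy_eq hτ]
  obtain ⟨Φ, Ψ, h, hξΦ⟩ := hξ
  have hle := weightedEnergy_lower_bound (α := α) hτ (h.right.hasFiniteEnergy_comp hζ)
  rw [h.right.weightedEnergy_comp hζ, ha, hb, hξΦ, hξΦ, h.left_inv _ (vert_pos _),
    h.left_inv _ (vert_pos _), vert, vert, Matrix.cons_val_zero, Matrix.cons_val_zero,
    Real.log_exp, Real.log_exp] at hle
  linarith

theorem eqOn_of_weightedEnergy_le (hξ : IsGeodesicLine ξ) (hτ : IsClock w τ a b)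
    (hζ : HasFiniteEnergy w a b ζ) (ha : ζ a = ξ (α * τ a + β)) (hb : ζ b = ξ (α * τ b + β))
    (hle : weightedEnergy w a b ζ ≤ weightedEnergy w a b fun x => ξ (α * τ x + β)) :
    EqOn ζ (fun x => ξ (α * τ x + β)) (uIcc a b) := by
  rw [hξ.weightedEnergy_eq hτ] at hle
  obtain ⟨Φ, Ψ, h, hξΦ⟩ := hξ
  have heq := eqOn_vert_of_weightedEnergy_le hτ (h.right.hasFiniteEnergy_comp hζ)
    (by rw [ha, hξΦ, h.left_inv _ (vert_pos _)]) (by rw [hb, hξΦ, h.left_inv _ (vert_pos _)])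
    (by rwa [h.right.weightedEnergy_comp hζ])
  intro x hx
  exact (h.right_inv _ (hζ.pos x hx)).symm.trans ((congrArg Φ (heq hx)).trans (hξΦ _).symm)

end IsGeodesicLine

end WeightedEnergy

section Distance

variable {c ξ : ℝ → Fin 4 → ℝ} {b : (Fin 4 → ℝ) → ℝ}

theorem continuousOn_gH {S : Set ℝ} {c v : ℝ → Fin 4 → ℝ} (hc : ContinuousOn c S)
    (hv : ContinuousOn v S) (hpos : ∀ s ∈ S, 0 < c s 0) :
    ContinuousOn (fun s => gH (c s) (v s) (v s)) S := by
  have hne : ∀ s ∈ S, c s 0 ≠ 0 := fun s hs => (hpos s hs).ne'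
  have hne_sq : ∀ s ∈ S, c s 0 ^ 2 ≠ 0 := fun s hs => pow_ne_zero 2 (hne s hs)
  unfold gH contactForm
  fun_prop (disch := assumption)

theorem intervalIntegrable_sqrt_gH_deriv (hc : ContDiffOn ℝ 1 c (Icc 0 1))
    (hpos : ∀ s ∈ Icc (0 : ℝ) 1, 0 < c s 0) :
    IntervalIntegrable (fun s => √(gH (c s) (deriv c s) (deriv c s))) volume 0 1 := by
  have hcont : ContinuousOn (fun s => √(gH (c s) (derivWithin c (Icc 0 1) s)
      (derivWithin c (Icc 0 1) s))) (uIcc 0 1) := by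
    rw [uIcc_of_le zero_le_one]
    exact (continuousOn_gH hc.continuousOn
      (hc.continuousOn_derivWithin (uniqueDiffOn_Icc one_pos) le_rfl) hpos).sqrt
  refine hcont.intervalIntegrable.congr_ae (ae_restrict_uIoc_of_ae ?_)
  filter_upwards [ae_mem_Ioo_of_mem_uIcc zero_le_one] with s hs hsm
  rw [derivWithin_of_mem_nhds (Icc_mem_nhds (hs hsm).1 (hs hsm).2)]

theorem IsCalibration.sub_le_curveLength (hb : IsCalibration b) (hc : ContDiffOn ℝ 1 c (Icc 0 1))
    (hpos : ∀ s ∈ Icc (0 : ℝ) 1, 0 < c s 0) : b (c 1) - b (c 0) ≤ curveLength c := by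
  have hbc : AbsolutelyContinuousOnInterval (fun s => b (c s)) 0 1 := by
    rw [← uIcc_of_le zero_le_one] at hc hpos
    exact absolutelyContinuousOnInterval_comp_of_contDiffAt
      (fun s hs => (hb.contDiffAt _ (hpos s hs)).of_le (by simp))
      hc.absolutelyContinuousOnInterval
  rw [← hbc.integral_deriv_eq_sub]
  refine intervalIntegral.integral_mono_on_of_le_Ioo zero_le_one hbc.intervalIntegrable_deriv
    (intervalIntegrable_sqrt_gH_deriv hc hpos) fun s hs => ?_
  have hx := hpos s (Ioo_subset_Icc_self hs)
  have hcs : DifferentiableAt ℝ c s :=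
    (hc.differentiableOn one_ne_zero s (Ioo_subset_Icc_self hs)).differentiableAt
      (Icc_mem_nhds hs.1 hs.2)
  have hbcs : HasDerivAt (fun s => b (c s)) (fderiv ℝ b (c s) (deriv c s)) s :=
    ((hb.contDiffAt _ hx).differentiableAt (by simp)).hasFDerivAt.comp_hasDerivAt s hcs.hasDerivAt
  rw [hbcs.deriv]
  exact Real.le_sqrt_of_sq_le (hb.sq_le _ _ hx)

theorem IsUnitSpeedGeodesic.curveLength_affine (hξ : IsUnitSpeedGeodesic ξ) {α : ℝ} (hα : 0 ≤ α)
    (β : ℝ) : curveLength (fun s => ξ (α * s + β)) = α := by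
  have hderiv (s : ℝ) :
      deriv (fun s => ξ (α * s + β)) s = α • deriv ξ (α * s + β) := by
    have haff : HasDerivAt (fun s => α * s + β) α s := by
      simpa using! ((hasDerivAt_id s).const_mul α).add_const β
    exact ((hξ.smooth.differentiable (by simp) _).hasDerivAt.scomp s haff).deriv
  simp only [curveLength, hderiv, gH_smul_smul, hξ.unit_speed, mul_one, Real.sqrt_sq hα,
    intervalIntegral.integral_const, sub_zero, one_smul]

theorem IsGeodesicLine.hdist_eq (hξ : IsGeodesicLine ξ) {s₁ s₂ : ℝ} (hs : s₁ ≤ s₂) :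
    hdist (ξ s₁) (ξ s₂) = s₂ - s₁ := by
  have hgeo := hξ.isUnitSpeedGeodesic
  refine IsLeast.csInf_eq ⟨⟨fun u => ξ ((s₂ - s₁) * u + s₁), ?_, fun u _ => hgeo.pos _, by simp,
    by simp, (hgeo.curveLength_affine (sub_nonneg.2 hs) s₁).symm⟩, ?_⟩
  · exact ((hgeo.smooth.of_le (by simp)).comp
      (f := fun u : ℝ => (s₂ - s₁) * u + s₁) (by fun_prop)).contDiffOn
  · rintro _ ⟨c, hc, hpos, h₀, h₁, rfl⟩
    obtain ⟨Φ, Ψ, h, hξΦ⟩ := hξ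
    have hle := h.right.isCalibration_log.sub_le_curveLength hc hpos
    rw [h₀, h₁, hξΦ, hξΦ, h.left_inv _ (vert_pos _), h.left_inv _ (vert_pos _)] at hle
    simpa [vert] using hle

theorem IsGeodesicLine.isAffineMinimizingGeodesic (hξ : IsGeodesicLine ξ)
    {γ : ℝ → Fin 4 → ℝ} {t₁ t₂ α β : ℝ} (hα : 0 ≤ α) (ht : t₁ ≤ t₂)
    (hγ : EqOn γ (fun t => ξ (α * t + β)) (Icc t₁ t₂)) :
    IsAffineMinimizingGeodesic γ t₁ t₂ α := by
  refine ⟨hα, ⟨ξ, β, hξ.isUnitSpeedGeodesic, fun t ht => hγ ht⟩, ?_⟩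
  rw [hγ (left_mem_Icc.2 ht), hγ (right_mem_Icc.2 ht), hξ.hdist_eq (by gcongr)]
  ring

end Distance

section Energy

variable {ξ ζ : ℝ → Fin 4 → ℝ} {p q : Fin 4 → ℝ} {t₁ t₂ α β : ℝ}

theorem isClock_one (ht : t₁ < t₂) : IsClock (fun _ => 1) (fun t => t) t₁ t₂ where
  lt := ht
  pos _ _ := one_pos
  contDiffOn := contDiffOn_id
  hasDerivAt t _ := by simpa using hasDerivAt_id' t

theorem energyAdmissible_iff (ht : t₁ ≤ t₂) :
    EnergyAdmissible t₁ t₂ p q ζ ↔ HasFiniteEnergy (fun _ => 1) t₁ t₂ ζ ∧ ζ t₁ = p ∧ ζ t₂ = q := by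
  constructor
  · rintro ⟨hac, hpos, hfin, hl, hr⟩
    exact ⟨⟨absolutelyContinuousOnInterval_pi hac, uIcc_of_le ht ▸ hpos,
      by simpa only [one_mul] using hfin⟩, hl, hr⟩
  · rintro ⟨⟨hac, hpos, hfin⟩, hl, hr⟩
    exact ⟨absolutelyContinuousOnInterval_apply hac, uIcc_of_le ht ▸ hpos,
      by simpa only [one_mul] using hfin, hl, hr⟩

theorem weightedEnergy_one (ζ : ℝ → Fin 4 → ℝ) :
    weightedEnergy (fun _ => 1) t₁ t₂ ζ = energy t₁ t₂ ζ := by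
  simp only [weightedEnergy, one_mul, energy]

theorem IsGeodesicLine.isEnergyMinimizer (hξ : IsGeodesicLine ξ) (ht : t₁ < t₂) :
    IsEnergyMinimizer t₁ t₂ (ξ (α * t₁ + β)) (ξ (α * t₂ + β)) fun t => ξ (α * t + β) := by
  refine ⟨(energyAdmissible_iff ht.le).2
    ⟨hξ.hasFiniteEnergy (isClock_one ht), rfl, rfl⟩, fun ζ hζ => ?_⟩
  obtain ⟨hζ, hl, hr⟩ := (energyAdmissible_iff ht.le).1 hζ
  rw [← weightedEnergy_one, ← weightedEnergy_one]
  exact hξ.weightedEnergy_le (isClock_one ht) hζ hl hr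

theorem IsGeodesicLine.eqOn_of_isEnergyMinimizer (hξ : IsGeodesicLine ξ) (ht : t₁ < t₂)
    (hζ : IsEnergyMinimizer t₁ t₂ (ξ (α * t₁ + β)) (ξ (α * t₂ + β)) ζ) :
    EqOn ζ (fun t => ξ (α * t + β)) (Icc t₁ t₂) := by
  obtain ⟨hadm, hmin⟩ := hζ
  obtain ⟨hfin, hl, hr⟩ := (energyAdmissible_iff ht.le).1 hadm
  have hle := hmin _ (hξ.isEnergyMinimizer ht).1
  rw [← weightedEnergy_one, ← weightedEnergy_one] at hle
  rw [← uIcc_of_le ht.le]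
  exact hξ.eqOn_of_weightedEnergy_le (isClock_one ht) hfin hl hr hle

end Energy

section Mass

variable {ξ ζ y D : ℝ → Fin 4 → ℝ} {p q : Fin 4 → ℝ} {w : ℝ → ℝ} {a b θ θ₁ θ₂ α β : ℝ}

theorem absolutelyContinuousOnInterval_congr {X : Type*} [PseudoMetricSpace X] {f g : ℝ → X}
    (hf : AbsolutelyContinuousOnInterval f a b) (hfg : EqOn g f (uIcc a b)) :
    AbsolutelyContinuousOnInterval g a b := by
  refine Tendsto.congr' ?_ hf
  rw [EventuallyEq, eventually_inf_principal]
  refine .of_forall fun E hE => Finset.sum_congr rfl fun i hi => ?_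
  rw [hfg (hE.1 i hi).1, hfg (hE.1 i hi).2]

theorem energyDensity_congr (h : EqOn y ζ (Ioo a b)) :
    EqOn (energyDensity y) (energyDensity ζ) (Ioo a b) := by
  intro x hx
  rw [energyDensity, (h.eventuallyEq_of_mem (Ioo_mem_nhds hx.1 hx.2)).deriv_eq, h hx, energyDensity]

theorem mul_energyDensity_congr_ae (hab : a ≤ b) (h : EqOn y ζ (uIcc a b)) :
    (fun x => w x * energyDensity y x) =ᵐ[volume.restrict (uIoc a b)]
      fun x => w x * energyDensity ζ x := by
  refine ae_restrict_uIoc_of_ae ((ae_mem_Ioo_of_mem_uIcc hab).mono fun x hx hxm => ?_)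
  exact congrArg (w x * ·)
    (energyDensity_congr (h.mono (Ioo_subset_Icc_self.trans Icc_subset_uIcc)) (hx hxm))

theorem HasFiniteEnergy.congr (hab : a ≤ b) (hζ : HasFiniteEnergy w a b ζ)
    (h : EqOn y ζ (uIcc a b)) : HasFiniteEnergy w a b y where
  ac := absolutelyContinuousOnInterval_congr hζ.ac h
  pos x hx := by rw [h hx]; exact hζ.pos x hx
  finite := hζ.finite.congr_ae (mul_energyDensity_congr_ae hab h).symm

theorem weightedEnergy_congr (hab : a ≤ b) (h : EqOn y ζ (uIcc a b)) :
    weightedEnergy w a b y = weightedEnergy w a b ζ :=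
  intervalIntegral.integral_congr_ae_restrict (mul_energyDensity_congr_ae hab h)

theorem tan_half_pos (h₀ : 0 < θ) (hπ : θ < π) : 0 < Real.tan (θ / 2) :=
  Real.tan_pos_of_pos_of_lt_pi_div_two (by linarith) (by linarith)

theorem thetaOf_tOf (h₀ : 0 < θ) (hπ : θ < π) : thetaOf (tOf θ) = θ := by
  rw [thetaOf, tOf, Real.exp_log (tan_half_pos h₀ hπ),
    Real.arctan_tan (by linarith) (by linarith)]
  ring

theorem tOf_thetaOf (t : ℝ) : tOf (thetaOf t) = t := by
  rw [thetaOf, tOf, mul_div_cancel_left₀ _ two_ne_zero, Real.tan_arctan, Real.log_exp]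

theorem sin_eq_two_mul_sin_half_mul_cos_half (θ : ℝ) :
    Real.sin θ = 2 * Real.sin (θ / 2) * Real.cos (θ / 2) := by
  rw [← Real.sin_two_mul, mul_div_cancel₀ θ two_ne_zero]

theorem hasDerivAt_tOf (h₀ : 0 < θ) (hπ : θ < π) : HasDerivAt tOf (1 / Real.sin θ) θ := by
  have hcos : 0 < Real.cos (θ / 2) := Real.cos_pos_of_mem_Ioo ⟨by linarith, by linarith⟩
  have hsin : 0 < Real.sin (θ / 2) := Real.sin_pos_of_pos_of_lt_pi (by linarith) (by linarith)
  have hhalf : HasDerivAt (fun θ : ℝ => θ / 2) (1 / 2) θ := (hasDerivAt_id θ).div_const 2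
  have htan := (Real.hasDerivAt_tan hcos.ne').comp θ hhalf
  have hlog : HasDerivAt tOf _ θ := htan.log (tan_half_pos h₀ hπ).ne'
  convert hlog using 1
  rw [sin_eq_two_mul_sin_half_mul_cos_half, Function.comp_apply, Real.tan_eq_sin_div_cos]
  field_simp

theorem contDiffAt_tOf (h₀ : 0 < θ) (hπ : θ < π) : ContDiffAt ℝ ∞ tOf θ := by
  have hcos : 0 < Real.cos (θ / 2) := Real.cos_pos_of_mem_Ioo ⟨by linarith, by linarith⟩
  exact ((Real.contDiffAt_tan.2 hcos.ne').comp θ (f := fun θ : ℝ => θ / 2) (by fun_prop)).log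
    (tan_half_pos h₀ hπ).ne'

theorem tOf_lt_tOf (h₁ : 0 < θ₁) (h₁₂ : θ₁ < θ₂) (h₂ : θ₂ < π) : tOf θ₁ < tOf θ₂ :=
  Real.log_lt_log (tan_half_pos h₁ (h₁₂.trans h₂))
    (Real.tan_lt_tan_of_lt_of_lt_pi_div_two (by linarith) (by linarith) (by linarith))

theorem monotone_thetaOf : Monotone thetaOf := fun _ _ h =>
  mul_le_mul_of_nonneg_left (Real.arctan_strictMono.monotone (Real.exp_le_exp.2 h)) zero_le_two

theorem thetaOf_mem_Icc (h₁ : 0 < θ₁) (h₁₂ : θ₁ ≤ θ₂) (h₂ : θ₂ < π) {t : ℝ}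
    (ht : t ∈ Icc (tOf θ₁) (tOf θ₂)) : thetaOf t ∈ Icc θ₁ θ₂ := by
  have hmem := monotone_thetaOf.mapsTo_Icc ht
  rwa [thetaOf_tOf h₁ (h₁₂.trans_lt h₂), thetaOf_tOf (h₁.trans_le h₁₂) h₂] at hmem

theorem sin_pos_of_mem_Icc (h₁ : 0 < θ₁) (h₂ : θ₂ < π) (hθ : θ ∈ Icc θ₁ θ₂) : 0 < Real.sin θ :=
  Real.sin_pos_of_pos_of_lt_pi (h₁.trans_le hθ.1) (hθ.2.trans_lt h₂)

theorem isClock_sin (h₁ : 0 < θ₁) (h₁₂ : θ₁ < θ₂) (h₂ : θ₂ < π) :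
    IsClock Real.sin tOf θ₁ θ₂ where
  lt := h₁₂
  pos _ hx := sin_pos_of_mem_Icc h₁ h₂ hx
  contDiffOn _ hx :=
    (contDiffAt_tOf (h₁.trans_le hx.1) (hx.2.trans_lt h₂)).contDiffWithinAt
  hasDerivAt _ hx := hasDerivAt_tOf (h₁.trans hx.1) (hx.2.trans h₂)

/-- The point `(e^σ sin² θ, ω, ψ, χ)` of the complex hyperbolic plane given by the values
`(σ, ω, ψ, χ)` of potentials at the angle `θ`. -/
def pointOf (θ : ℝ) (p : Fin 4 → ℝ) : Fin 4 → ℝ :=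
  ![Real.exp (p 0) * Real.sin θ ^ 2, p 1, p 2, p 3]

/-- The inverse of `pointOf θ`: the values of the potentials at the angle `θ` which give the
point `x` with `0 < x 0`. -/
def potentialOf (θ : ℝ) (x : Fin 4 → ℝ) : Fin 4 → ℝ :=
  ![Real.log (x 0) - 2 * Real.log (Real.sin θ), x 1, x 2, x 3]

theorem pointOf_pos (hθ : 0 < Real.sin θ) (p : Fin 4 → ℝ) : 0 < pointOf θ p 0 :=
  mul_pos (Real.exp_pos _) (pow_pos hθ 2)

theorem pointOf_potentialOf (hθ : 0 < Real.sin θ) {x : Fin 4 → ℝ} (hx : 0 < x 0) :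
    pointOf θ (potentialOf θ x) = x := by
  ext k
  fin_cases k
  · change Real.exp (Real.log (x 0) - 2 * Real.log (Real.sin θ)) * Real.sin θ ^ 2 = x 0
    rw [Real.exp_sub, Real.exp_log hx, two_mul, Real.exp_add, Real.exp_log hθ]
    field_simp
  all_goals rfl

theorem potentialOf_pointOf (hθ : 0 < Real.sin θ) (p : Fin 4 → ℝ) :
    potentialOf θ (pointOf θ p) = p := by
  ext k
  fin_cases k
  · change Real.log (Real.exp (p 0) * Real.sin θ ^ 2) - 2 * Real.log (Real.sin θ) = p 0
    rw [Real.log_mul (Real.exp_ne_zero _) (pow_pos hθ 2).ne', Real.log_exp, Real.log_pow]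
    push_cast
    ring
  all_goals rfl

theorem hasDerivAt_pointOf (hD : DifferentiableAt ℝ D θ) :
    HasDerivAt (fun θ => pointOf θ (D θ))
      ![Real.exp (D θ 0) * deriv D θ 0 * Real.sin θ ^ 2
        + Real.exp (D θ 0) * (2 * Real.sin θ * Real.cos θ),
        deriv D θ 1, deriv D θ 2, deriv D θ 3] θ := by
  have hk (k : Fin 4) := hasDerivAt_pi.1 hD.hasDerivAt k
  refine hasDerivAt_pi.2 fun k => ?_
  fin_cases k
  · simpa using! (hk 0).exp.fun_mul ((Real.hasDerivAt_sin θ).fun_pow 2)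
  exacts [hk 1, hk 2, hk 3]

theorem massDensity_eq (hθ : 0 < Real.sin θ) (hD : DifferentiableAt ℝ D θ) :
    massDensity D θ = Real.sin θ * energyDensity (fun θ => pointOf θ (D θ)) θ
      - deriv (fun θ => 4 * Real.cos θ * D θ 0) θ - 4 * Real.cos θ ^ 2 / Real.sin θ := by
  have hboundary : HasDerivAt (fun θ => 4 * Real.cos θ * D θ 0)
      (4 * -Real.sin θ * D θ 0 + 4 * Real.cos θ * deriv D θ 0) θ :=
    ((Real.hasDerivAt_cos θ).const_mul 4).fun_mul (hasDerivAt_pi.1 hD.hasDerivAt 0)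
  rw [energyDensity, (hasDerivAt_pointOf hD).deriv, hboundary.deriv]
  simp only [massDensity, gH, contactForm, pointOf, etaOf, Matrix.cons_val]
  have hexp := (Real.exp_pos (D θ 0)).ne'
  field_simp
  ring

theorem absolutelyContinuousOnInterval_pointOf (hD : AbsolutelyContinuousOnInterval D θ₁ θ₂) :
    AbsolutelyContinuousOnInterval (fun θ => pointOf θ (D θ)) θ₁ θ₂ := by
  have hk := absolutelyContinuousOnInterval_apply hD
  refine absolutelyContinuousOnInterval_pi fun k => ?_
  fin_cases k
  · exact (absolutelyContinuousOnInterval_comp_of_contDiffAt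
      (fun _ _ => Real.contDiff_exp.contDiffAt) (hk 0)).fun_mul
      (ContDiffOn.absolutelyContinuousOnInterval (f := fun θ => Real.sin θ ^ 2) (by fun_prop))
  exacts [hk 1, hk 2, hk 3]

theorem absolutelyContinuousOnInterval_potentialOf (hsin : ∀ θ ∈ uIcc θ₁ θ₂, 0 < Real.sin θ)
    (hζ : AbsolutelyContinuousOnInterval ζ θ₁ θ₂) (hpos : ∀ θ ∈ uIcc θ₁ θ₂, 0 < ζ θ 0) :
    AbsolutelyContinuousOnInterval (fun θ => potentialOf θ (ζ θ)) θ₁ θ₂ := by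
  have hk := absolutelyContinuousOnInterval_apply hζ
  refine absolutelyContinuousOnInterval_pi fun k => ?_
  fin_cases k
  · exact (absolutelyContinuousOnInterval_comp_of_contDiffAt
      (fun θ hθ => Real.contDiffAt_log.2 (hpos θ hθ).ne') (hk 0)).fun_sub
      (ContDiffOn.absolutelyContinuousOnInterval (f := fun θ => 2 * Real.log (Real.sin θ))
        (contDiffOn_const.mul (Real.contDiff_sin.contDiffOn.log fun θ hθ => (hsin θ hθ).ne')))
  exacts [hk 1, hk 2, hk 3]

theorem absolutelyContinuousOnInterval_cos_mul (hD : AbsolutelyContinuousOnInterval D θ₁ θ₂) :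
    AbsolutelyContinuousOnInterval (fun θ => 4 * Real.cos θ * D θ 0) θ₁ θ₂ :=
  AbsolutelyContinuousOnInterval.fun_mul (f := fun θ => 4 * Real.cos θ)
    (ContDiffOn.absolutelyContinuousOnInterval (by fun_prop))
    (absolutelyContinuousOnInterval_apply hD 0)

theorem intervalIntegrable_cos_sq_div_sin (hsin : ∀ θ ∈ uIcc θ₁ θ₂, 0 < Real.sin θ) :
    IntervalIntegrable (fun θ => 4 * Real.cos θ ^ 2 / Real.sin θ) volume θ₁ θ₂ :=
  ContinuousOn.intervalIntegrable
    (ContinuousOn.div (by fun_prop) (by fun_prop) fun θ hθ => (hsin θ hθ).ne')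

theorem massDensity_ae_eq (hsin : ∀ θ ∈ uIcc θ₁ θ₂, 0 < Real.sin θ)
    (hD : AbsolutelyContinuousOnInterval D θ₁ θ₂) :
    massDensity D =ᵐ[volume.restrict (uIoc θ₁ θ₂)] fun θ =>
      Real.sin θ * energyDensity (fun θ => pointOf θ (D θ)) θ
        - deriv (fun θ => 4 * Real.cos θ * D θ 0) θ - 4 * Real.cos θ ^ 2 / Real.sin θ :=
  ae_restrict_uIoc_of_ae ((ae_differentiableAt_of_absolutelyContinuousOnInterval hD).mono
    fun θ hθ hθm => massDensity_eq (hsin θ hθm) (hθ hθm))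

theorem intervalIntegrable_massDensity_iff (hsin : ∀ θ ∈ uIcc θ₁ θ₂, 0 < Real.sin θ)
    (hD : AbsolutelyContinuousOnInterval D θ₁ θ₂) :
    IntervalIntegrable (massDensity D) volume θ₁ θ₂ ↔
      HasFiniteEnergy Real.sin θ₁ θ₂ fun θ => pointOf θ (D θ) := by
  have hboundary := (absolutelyContinuousOnInterval_cos_mul hD).intervalIntegrable_deriv
  have hcot := intervalIntegrable_cos_sq_div_sin hsin
  refine ⟨fun h => ⟨absolutelyContinuousOnInterval_pointOf hD,
    fun θ hθ => pointOf_pos (hsin θ hθ) _, ?_⟩, fun h =>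
    ((h.finite.sub hboundary).sub hcot).congr_ae (massDensity_ae_eq hsin hD).symm⟩
  refine (((h.congr_ae (massDensity_ae_eq hsin hD)).add hboundary).add hcot).congr_ae
    (.of_forall fun θ => ?_)
  ring

theorem mass_eq (hsin : ∀ θ ∈ uIcc θ₁ θ₂, 0 < Real.sin θ)
    (hD : AbsolutelyContinuousOnInterval D θ₁ θ₂)
    (hfin : HasFiniteEnergy Real.sin θ₁ θ₂ fun θ => pointOf θ (D θ)) :
    mass θ₁ θ₂ D = weightedEnergy Real.sin θ₁ θ₂ (fun θ => pointOf θ (D θ))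
      - (4 * Real.cos θ₂ * D θ₂ 0 - 4 * Real.cos θ₁ * D θ₁ 0)
      - ∫ θ in θ₁..θ₂, 4 * Real.cos θ ^ 2 / Real.sin θ := by
  have hboundary := absolutelyContinuousOnInterval_cos_mul hD
  rw [mass, intervalIntegral.integral_congr_ae_restrict (massDensity_ae_eq hsin hD),
    intervalIntegral.integral_sub (hfin.finite.sub hboundary.intervalIntegrable_deriv)
      (intervalIntegrable_cos_sq_div_sin hsin),
    intervalIntegral.integral_sub hfin.finite hboundary.intervalIntegrable_deriv,
    hboundary.integral_deriv_eq_sub, weightedEnergy]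

theorem massAdmissible_iff (hsin : ∀ θ ∈ uIcc θ₁ θ₂, 0 < Real.sin θ) :
    MassAdmissible θ₁ θ₂ p q D ↔ AbsolutelyContinuousOnInterval D θ₁ θ₂ ∧
      HasFiniteEnergy Real.sin θ₁ θ₂ (fun θ => pointOf θ (D θ)) ∧ D θ₁ = p ∧ D θ₂ = q := by
  constructor
  · rintro ⟨hac, hfin, hl, hr⟩
    have hD := absolutelyContinuousOnInterval_pi hac
    exact ⟨hD, (intervalIntegrable_massDensity_iff hsin hD).1 hfin, hl, hr⟩
  · rintro ⟨hD, hfin, hl, hr⟩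
    exact ⟨absolutelyContinuousOnInterval_apply hD,
      (intervalIntegrable_massDensity_iff hsin hD).2 hfin, hl, hr⟩

theorem mass_le_mass_iff (hsin : ∀ θ ∈ uIcc θ₁ θ₂, 0 < Real.sin θ) {E : ℝ → Fin 4 → ℝ}
    (hD : MassAdmissible θ₁ θ₂ p q D) (hE : MassAdmissible θ₁ θ₂ p q E) :
    mass θ₁ θ₂ D ≤ mass θ₁ θ₂ E ↔
      weightedEnergy Real.sin θ₁ θ₂ (fun θ => pointOf θ (D θ))
        ≤ weightedEnergy Real.sin θ₁ θ₂ fun θ => pointOf θ (E θ) := by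
  obtain ⟨hDac, hDfin, hDl, hDr⟩ := (massAdmissible_iff hsin).1 hD
  obtain ⟨hEac, hEfin, hEl, hEr⟩ := (massAdmissible_iff hsin).1 hE
  rw [mass_eq hsin hDac hDfin, mass_eq hsin hEac hEfin, hDl, hDr, hEl, hEr, sub_le_sub_iff_right,
    sub_le_sub_iff_right]

/-- The potentials whose curve is `ξ (α t + β)`. -/
def linePotentials (ξ : ℝ → Fin 4 → ℝ) (α β θ : ℝ) : Fin 4 → ℝ :=
  potentialOf θ (ξ (α * tOf θ + β))

namespace IsGeodesicLine

theorem pointOf_linePotentials (hξ : IsGeodesicLine ξ) (hθ : 0 < Real.sin θ) :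
    pointOf θ (linePotentials ξ α β θ) = ξ (α * tOf θ + β) :=
  pointOf_potentialOf hθ (hξ.isUnitSpeedGeodesic.pos _)

theorem massAdmissible (hξ : IsGeodesicLine ξ) (h₁ : 0 < θ₁) (h₁₂ : θ₁ < θ₂) (h₂ : θ₂ < π) :
    MassAdmissible θ₁ θ₂ (linePotentials ξ α β θ₁) (linePotentials ξ α β θ₂)
      (linePotentials ξ α β) := by
  have hsin : ∀ θ ∈ uIcc θ₁ θ₂, 0 < Real.sin θ := fun θ hθ =>
    sin_pos_of_mem_Icc h₁ h₂ (uIcc_of_le h₁₂.le ▸ hθ)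
  have hfin : HasFiniteEnergy Real.sin θ₁ θ₂ fun θ => ξ (α * tOf θ + β) :=
    hξ.hasFiniteEnergy (isClock_sin h₁ h₁₂ h₂)
  exact (massAdmissible_iff hsin).2
    ⟨absolutelyContinuousOnInterval_potentialOf hsin hfin.ac hfin.pos,
      hfin.congr h₁₂.le fun θ hθ => hξ.pointOf_linePotentials (hsin θ hθ), rfl, rfl⟩

theorem isMassMinimizer (hξ : IsGeodesicLine ξ) (h₁ : 0 < θ₁) (h₁₂ : θ₁ < θ₂) (h₂ : θ₂ < π) :
    IsMassMinimizer θ₁ θ₂ (linePotentials ξ α β θ₁) (linePotentials ξ α β θ₂)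
      (linePotentials ξ α β) := by
  have hsin : ∀ θ ∈ uIcc θ₁ θ₂, 0 < Real.sin θ := fun θ hθ =>
    sin_pos_of_mem_Icc h₁ h₂ (uIcc_of_le h₁₂.le ▸ hθ)
  have hline := hξ.massAdmissible (α := α) (β := β) h₁ h₁₂ h₂
  refine ⟨hline, fun E hE => ?_⟩
  obtain ⟨-, hfin, hl, hr⟩ := (massAdmissible_iff hsin).1 hE
  rw [mass_le_mass_iff hsin hline hE,
    weightedEnergy_congr h₁₂.le fun θ hθ => hξ.pointOf_linePotentials (hsin θ hθ)]
  exact hξ.weightedEnergy_le (isClock_sin h₁ h₁₂ h₂) hfin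
    (by rw [hl, hξ.pointOf_linePotentials (hsin _ left_mem_uIcc)])
    (by rw [hr, hξ.pointOf_linePotentials (hsin _ right_mem_uIcc)])

theorem eqOn_of_isMassMinimizer (hξ : IsGeodesicLine ξ) (h₁ : 0 < θ₁) (h₁₂ : θ₁ < θ₂)
    (h₂ : θ₂ < π)
    (hD : IsMassMinimizer θ₁ θ₂ (linePotentials ξ α β θ₁) (linePotentials ξ α β θ₂) D) :
    EqOn D (linePotentials ξ α β) (Icc θ₁ θ₂) := by
  have hsin : ∀ θ ∈ uIcc θ₁ θ₂, 0 < Real.sin θ := fun θ hθ =>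
    sin_pos_of_mem_Icc h₁ h₂ (uIcc_of_le h₁₂.le ▸ hθ)
  have hline := hξ.massAdmissible (α := α) (β := β) h₁ h₁₂ h₂
  obtain ⟨-, hfin, hl, hr⟩ := (massAdmissible_iff hsin).1 hD.1
  have hle := (mass_le_mass_iff hsin hD.1 hline).1 (hD.2 _ hline)
  rw [weightedEnergy_congr (y := fun θ => pointOf θ (linePotentials ξ α β θ)) h₁₂.le
    fun θ hθ => hξ.pointOf_linePotentials (hsin θ hθ)] at hle
  have heq := hξ.eqOn_of_weightedEnergy_le (isClock_sin h₁ h₁₂ h₂) hfin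
    (by rw [hl, hξ.pointOf_linePotentials (hsin _ left_mem_uIcc)])
    (by rw [hr, hξ.pointOf_linePotentials (hsin _ right_mem_uIcc)]) hle
  intro θ hθ
  rw [← potentialOf_pointOf (sin_pos_of_mem_Icc h₁ h₂ hθ) (D θ)]
  exact congrArg (potentialOf θ) (heq (uIcc_of_le h₁₂.le ▸ hθ))

theorem contDiffOn_linePotentials (hξ : IsGeodesicLine ξ) (h₁ : 0 < θ₁) (h₁₂ : θ₁ < θ₂)
    (h₂ : θ₂ < π) : ContDiffOn ℝ ∞ (linePotentials ξ α β) (Icc θ₁ θ₂) := by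
  have hξ := hξ.isUnitSpeedGeodesic
  have hτ := (isClock_sin h₁ h₁₂ h₂).contDiffOn
  have hk : ∀ k, ContDiffOn ℝ ∞ (fun θ => ξ (α * tOf θ + β) k) (Icc θ₁ θ₂) :=
    contDiffOn_pi.1 (hξ.smooth.comp_contDiffOn (f := fun θ => α * tOf θ + β) (by fun_prop))
  refine contDiffOn_pi.2 fun k => ?_
  fin_cases k
  · exact ((hk 0).log fun θ _ => (hξ.pos _).ne').sub (contDiffOn_const.mul
      (Real.contDiff_sin.contDiffOn.log fun θ hθ => (sin_pos_of_mem_Icc h₁ h₂ hθ).ne'))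
  exacts [hk 1, hk 2, hk 3]

theorem eqOn_curveOf_linePotentials (hξ : IsGeodesicLine ξ) (h₁ : 0 < θ₁) (h₁₂ : θ₁ ≤ θ₂)
    (h₂ : θ₂ < π) :
    EqOn (curveOf (linePotentials ξ α β)) (fun t => ξ (α * t + β)) (Icc (tOf θ₁) (tOf θ₂)) := by
  intro t ht
  have hsin := sin_pos_of_mem_Icc h₁ h₂ (thetaOf_mem_Icc h₁ h₁₂ h₂ ht)
  exact (hξ.pointOf_linePotentials hsin).trans (by rw [tOf_thetaOf])

end IsGeodesicLine

theorem exists_affine_through {t₁ t₂ s₁ s₂ : ℝ} (ht : t₁ < t₂) (hs : s₁ ≤ s₂) :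
    ∃ α β, 0 ≤ α ∧ α * t₁ + β = s₁ ∧ α * t₂ + β = s₂ := by
  have ht' : t₂ - t₁ ≠ 0 := (sub_pos.2 ht).ne'
  refine ⟨(s₂ - s₁) / (t₂ - t₁), s₁ - (s₂ - s₁) / (t₂ - t₁) * t₁,
    div_nonneg (sub_nonneg.2 hs) (sub_pos.2 ht).le, by ring, ?_⟩
  field_simp
  ring

theorem exists_isGeodesicLine_linePotentials (h₁ : 0 < θ₁) (h₁₂ : θ₁ < θ₂) (h₂ : θ₂ < π)
    (p q : Fin 4 → ℝ) : ∃ ξ α β, IsGeodesicLine ξ ∧ 0 ≤ α ∧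
      linePotentials ξ α β θ₁ = p ∧ linePotentials ξ α β θ₂ = q := by
  have hsin₁ := sin_pos_of_mem_Icc h₁ h₂ (left_mem_Icc.2 h₁₂.le)
  have hsin₂ := sin_pos_of_mem_Icc h₁ h₂ (right_mem_Icc.2 h₁₂.le)
  obtain ⟨ξ, s₁, s₂, hξ, hs, hξ₁, hξ₂⟩ :=
    exists_isGeodesicLine (pointOf_pos hsin₁ p) (pointOf_pos hsin₂ q)
  obtain ⟨α, β, hα, hαβ₁, hαβ₂⟩ := exists_affine_through (tOf_lt_tOf h₁ h₁₂ h₂) hs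
  exact ⟨ξ, α, β, hξ, hα, by rw [linePotentials, hαβ₁, hξ₁, potentialOf_pointOf hsin₁],
    by rw [linePotentials, hαβ₂, hξ₂, potentialOf_pointOf hsin₂]⟩

theorem exists_isMassMinimizer (h₁ : 0 < θ₁) (h₁₂ : θ₁ < θ₂) (h₂ : θ₂ < π) (p q : Fin 4 → ℝ) :
    ∃ D : ℝ → Fin 4 → ℝ, IsMassMinimizer θ₁ θ₂ p q D ∧
      (∀ E, IsMassMinimizer θ₁ θ₂ p q E → EqOn E D (Icc θ₁ θ₂)) ∧
      ContDiffOn ℝ ∞ D (Icc θ₁ θ₂) ∧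
      ∃ α : ℝ, IsAffineMinimizingGeodesic (curveOf D) (tOf θ₁) (tOf θ₂) α := by
  obtain ⟨ξ, α, β, hξ, hα, rfl, rfl⟩ := exists_isGeodesicLine_linePotentials h₁ h₁₂ h₂ p q
  exact ⟨linePotentials ξ α β, hξ.isMassMinimizer h₁ h₁₂ h₂,
    fun E hE => hξ.eqOn_of_isMassMinimizer h₁ h₁₂ h₂ hE, hξ.contDiffOn_linePotentials h₁ h₁₂ h₂,
    α, hξ.isAffineMinimizingGeodesic hα (tOf_lt_tOf h₁ h₁₂ h₂).le
      (hξ.eqOn_curveOf_linePotentials h₁ h₁₂.le h₂)⟩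

end Mass

end Variational

section ExplicitCurves

open Complex ComplexConjugate

/-! ### The explicit curves as geodesic lines -/

theorem tanh_half (x : ℝ) : Real.tanh (x / 2) = Real.sinh x / (Real.cosh x + 1) := by
  have := Real.cosh_pos (x / 2)
  have hone : Real.cosh x + 1 = 2 * Real.cosh (x / 2) ^ 2 := by
    rw [← mul_div_cancel₀ x two_ne_zero, Real.cosh_two_mul, mul_div_cancel_left₀ _ two_ne_zero,
      Real.sinh_sq]
    ring
  have hsinh : Real.sinh x = 2 * Real.sinh (x / 2) * Real.cosh (x / 2) := by
    rw [← Real.sinh_two_mul, mul_div_cancel₀ x two_ne_zero]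
  rw [hone, hsinh, Real.tanh_eq_sinh_div_cosh]
  field_simp

theorem cosh_eq_exp_half (x : ℝ) :
    Real.cosh x = (Real.exp (x / 2) ^ 2 + Real.exp (-(x / 2)) ^ 2) / 2 := by
  rw [Real.cosh_eq, ← Real.exp_nat_mul, ← Real.exp_nat_mul]
  push_cast
  ring_nf

theorem sinh_eq_exp_half (x : ℝ) :
    Real.sinh x = (Real.exp (x / 2) ^ 2 - Real.exp (-(x / 2)) ^ 2) / 2 := by
  rw [Real.sinh_eq, ← Real.exp_nat_mul, ← Real.exp_nat_mul]
  push_cast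
  ring_nf

theorem exp_half_mul_exp_neg_half (x : ℝ) :
    (Real.exp (x / 2) : ℂ) * Real.exp (-(x / 2)) = 1 := by
  rw [← ofReal_mul, ← Real.exp_add, add_neg_cancel, Real.exp_zero, ofReal_one]

theorem cos_two_mul_arctan (y : ℝ) : Real.cos (2 * Real.arctan y) = 2 / (1 + y ^ 2) - 1 := by
  rw [Real.cos_two_mul, Real.cos_sq_arctan, mul_one_div]

theorem sin_two_mul_arctan (y : ℝ) : Real.sin (2 * Real.arctan y) = 2 * y / (1 + y ^ 2) := by
  rw [Real.sin_two_mul, mul_assoc, Real.sin_arctan, Real.cos_arctan, div_mul_div_comm, mul_one,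
    Real.mul_self_sqrt (by positivity), mul_div_assoc]

theorem sign_mul_abs_sinh {α : ℝ} (hα : 0 < α) (t : ℝ) :
    Real.sign t * |Real.sinh (α * t)| = Real.sinh (α * t) := by
  rcases lt_trichotomy t 0 with ht | rfl | ht
  · rw [Real.sign_of_neg ht, abs_of_neg (Real.sinh_neg_iff.2 (mul_neg_of_pos_of_neg hα ht)),
      neg_one_mul, neg_neg]
  · simp
  · rw [Real.sign_of_pos ht, abs_of_pos (Real.sinh_pos_iff.2 (mul_pos hα ht)), one_mul]

namespace Consts

variable {c : Consts}

/-- The constant `√(4 c₁² + c₅⁴)` of the explicit curves. -/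
def rad (c : Consts) : ℝ := √(4 * c.c₁ ^ 2 + c.c₅ ^ 4)

/-- The common denominator `c₅² + √(4 c₁² + c₅⁴) cosh (α t)` of the coordinates of the explicit
curves. -/
def den (c : Consts) (t : ℝ) : ℝ := c.c₅ ^ 2 + c.rad * Real.cosh (c.α * t)

theorem rad_sq (c : Consts) : c.rad ^ 2 = 4 * c.c₁ ^ 2 + c.c₅ ^ 4 :=
  Real.sq_sqrt (by positivity)

theorem rad_pos (hc : c.c₁ ≠ 0) : 0 < c.rad :=
  Real.sqrt_pos.2 (by positivity)

theorem den_pos (hc : c.c₁ ≠ 0) (t : ℝ) : 0 < c.den t := by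
  have := rad_pos hc
  have := Real.cosh_pos (c.α * t)
  unfold den
  positivity

theorem eta_eq (c : Consts) (t : ℝ) : c.eta t = 2 / c.den t := by
  have h : 1 / 2 * c.c₅ ^ 2 + 1 / 2 * √(4 * c.c₁ ^ 2 + c.c₅ ^ 4) * Real.cosh (c.α * t)
      = c.den t / 2 := by
    rw [den, rad]
    ring
  rw [eta, h, inv_div]

theorem f_eq (hc : c.c₁ ≠ 0) (t : ℝ) :
    c.f t = -(2 * Real.arctan
      (2 * c.c₁ * Real.sinh (c.α * t) / ((c.rad + c.c₅ ^ 2) * (Real.cosh (c.α * t) + 1)))) := by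
  have := rad_pos hc
  have := Real.cosh_pos (c.α * t)
  rw [f, tanh_half, neg_mul, neg_inj, ← rad]
  congr 2
  field_simp
  linear_combination Real.sinh (c.α * t) * c.rad_sq

theorem one_add_tan_sq (hc : c.c₁ ≠ 0) (t : ℝ) :
    1 + (2 * c.c₁ * Real.sinh (c.α * t) / ((c.rad + c.c₅ ^ 2) * (Real.cosh (c.α * t) + 1))) ^ 2
      = 2 * c.den t / ((c.rad + c.c₅ ^ 2) * (Real.cosh (c.α * t) + 1)) := by
  have := rad_pos hc
  have := Real.cosh_pos (c.α * t)
  have hsq := Real.sinh_sq (c.α * t)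
  rw [den]
  field_simp
  rw [hsq]
  linear_combination (1 - Real.cosh (c.α * t) ^ 2) * c.rad_sq

theorem cos_f (hc : c.c₁ ≠ 0) (t : ℝ) :
    Real.cos (c.f t) = (c.rad + c.c₅ ^ 2 * Real.cosh (c.α * t)) / c.den t := by
  have := rad_pos hc
  have := Real.cosh_pos (c.α * t)
  have := den_pos hc t
  rw [f_eq hc, Real.cos_neg, cos_two_mul_arctan, one_add_tan_sq hc]
  field_simp
  rw [den]
  ring

theorem sin_f (hc : c.c₁ ≠ 0) (t : ℝ) :
    Real.sin (c.f t) = -(2 * c.c₁ * Real.sinh (c.α * t)) / c.den t := by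
  have := rad_pos hc
  have := Real.cosh_pos (c.α * t)
  have := den_pos hc t
  rw [f_eq hc, Real.sin_neg, sin_two_mul_arctan, one_add_tan_sq hc]
  field_simp

theorem chiPsi_eq (c : Consts) (t : ℝ) :
    c.chiPsi t = ⟨c.c₄ * Real.cos (c.f t) + c.c₃ / c.c₁, c.c₄ * Real.sin (c.f t)⟩ := by
  rw [chiPsi, mul_comm Complex.I, Complex.exp_mul_I]
  apply Complex.ext <;> simp [← Complex.ofReal_cos, ← Complex.ofReal_sin]

theorem Valid.omega_eq (hc : c.Valid) (t : ℝ) :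
    c.omega t = c.rad * Real.sinh (c.α * t) / (c.c₁ * c.den t)
      - 2 * (c.c₃ / c.c₁) * (c.chiPsi t).im := by
  obtain ⟨hc₁, hc₅, hα⟩ := hc
  have hden := den_pos hc₁ t
  have hradicand : 1 - c.c₁ ^ 2 * c.eta t ^ 2 - 4 * c.c₁ ^ 2 * c.c₄ ^ 2 * c.eta t
      = (c.rad * Real.sinh (c.α * t) / c.den t) ^ 2 := by
    rw [eta_eq, show 4 * c.c₁ ^ 2 * c.c₄ ^ 2 = c.c₅ ^ 2 by rw [hc₅]; ring]
    field_simp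
    rw [Real.sinh_sq, den]
    linear_combination c.rad_sq
  have hsgn := sign_mul_abs_sinh hα t
  rw [omega, hradicand, Real.sqrt_sq_eq_abs, abs_div, abs_mul, abs_of_pos (rad_pos hc₁),
    abs_of_pos hden]
  field_simp
  linear_combination c.rad * hsgn

theorem Valid.curve_eq (hc : c.Valid) (t : ℝ) :
    c.curve t = ![2 / c.den t,
      (c.rad + 2 * c.c₃ * c.c₅) * Real.sinh (c.α * t) / (c.c₁ * c.den t),
      -(c.c₅ * Real.sinh (c.α * t)) / c.den t,
      (c.c₅ * (c.rad + c.c₅ ^ 2 * Real.cosh (c.α * t)) / c.den t + 2 * c.c₃) / (2 * c.c₁)] := by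
  obtain ⟨hc₁, hc₅, -⟩ := id hc
  have := den_pos hc₁ t
  rw [curve, eta_eq, hc.omega_eq, chiPsi_eq, cos_f hc₁, sin_f hc₁]
  ext k
  fin_cases k <;> simp [hc₅] <;> field_simp
  ring

theorem Valid.curve_neg (hc : c.Valid) (t : ℝ) :
    c.curve (-t) = ![c.curve t 0, -c.curve t 1, -c.curve t 2, c.curve t 3] := by
  rw [hc.curve_eq, hc.curve_eq]
  ext k
  fin_cases k <;> simp [den] <;> ring

theorem Valid.lift_curve (hc : c.Valid) (t : ℝ) :
    lift (c.curve t) = ![2 / c.den t - I * c.rad * Real.sinh (c.α * t) / (c.c₁ * c.den t)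
        + c.c₄ ^ 2 + 2 * (c.c₃ / c.c₁) * c.c₄ * cexp (I * c.f t) + (c.c₃ / c.c₁) ^ 2,
      c.c₄ * cexp (I * c.f t) + c.c₃ / c.c₁, 1] := by
  simp only [lift, curve, Matrix.cons_val, hc.omega_eq, chiPsi_eq, eta_eq, mul_comm I (c.f t : ℂ),
    exp_mul_I]
  push_cast [Matrix.vecCons_inj]
  refine ⟨?_, by ring, rfl, rfl⟩
  linear_combination (c.c₄ : ℂ) ^ 2 * Complex.cos_sq_add_sin_sq (c.f t)

theorem cexp_f (hc : c.c₁ ≠ 0) (t : ℝ) :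
    cexp (I * c.f t) = (c.rad + c.c₅ ^ 2 * Real.cosh (c.α * t)
      - 2 * I * c.c₁ * Real.sinh (c.α * t)) / c.den t := by
  rw [mul_comm, exp_mul_I, ← ofReal_cos, ← ofReal_sin, cos_f hc, sin_f hc]
  push_cast
  ring

/-- The null vectors that span the ends of the geodesic parametrized by the explicit curve. -/
def endpoints (c : Consts) : (Fin 3 → ℂ) × (Fin 3 → ℂ) :=
  let w : ℂ := c.c₅ ^ 2 + 2 * I * c.c₁
  let a : ℂ := c.c₃ / c.c₁
  (![w * (c.c₄ ^ 2 - I / c.c₁) + 2 * a * c.c₄ * c.rad + a ^ 2 * w, a * w + c.c₄ * c.rad, w],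
    ![c.rad * (c.c₄ ^ 2 + I / c.c₁) + 2 * a * c.c₄ * w + a ^ 2 * c.rad,
      a * c.rad + c.c₄ * w, c.rad])

theorem ofReal_rad_sq (c : Consts) : (c.rad : ℂ) ^ 2 = 4 * c.c₁ ^ 2 + c.c₅ ^ 4 := by
  exact_mod_cast c.rad_sq

theorem herm_endpoints_fst (c : Consts) : herm c.endpoints.1 c.endpoints.1 = 0 := by
  simp only [endpoints, herm, Matrix.cons_val, map_add, map_sub, map_mul, map_div₀, map_pow,
    map_ofNat, conj_ofReal, conj_I]
  linear_combination -2 * (c.c₄ : ℂ) ^ 2 * c.ofReal_rad_sq - 8 * (c.c₄ : ℂ) ^ 2 * c.c₁ ^ 2 * I_sq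

theorem herm_endpoints_snd (c : Consts) : herm c.endpoints.2 c.endpoints.2 = 0 := by
  simp only [endpoints, herm, Matrix.cons_val, map_add, map_mul, map_div₀, map_pow,
    map_ofNat, conj_ofReal, conj_I]
  linear_combination 2 * (c.c₄ : ℂ) ^ 2 * c.ofReal_rad_sq + 8 * (c.c₄ : ℂ) ^ 2 * c.c₁ ^ 2 * I_sq

theorem Valid.herm_endpoints (hc : c.Valid) :
    herm c.endpoints.1 c.endpoints.2 = (4 * c.rad : ℝ) := by
  obtain ⟨hc₁, hc₅, -⟩ := hc
  have : (c.c₁ : ℂ) ≠ 0 := ofReal_ne_zero.2 hc₁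
  simp only [endpoints, herm, Matrix.cons_val, map_add, map_mul, map_div₀, map_pow,
    map_ofNat, conj_ofReal, conj_I, hc₅]
  push_cast
  field_simp
  linear_combination -4 * (c.rad : ℂ) * c.c₁ * I_sq

theorem cexp_f_mul (hc : c.c₁ ≠ 0) (t : ℝ) :
    cexp (I * c.f t) * (Real.exp (c.α * t / 2) * (c.c₅ ^ 2 + 2 * I * c.c₁)
        + Real.exp (-(c.α * t / 2)) * c.rad)
      = Real.exp (c.α * t / 2) * c.rad
        + Real.exp (-(c.α * t / 2)) * (c.c₅ ^ 2 + 2 * I * c.c₁) := by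
  have hden := ofReal_ne_zero.2 (den_pos hc t).ne'
  have hexp := exp_half_mul_exp_neg_half (c.α * t)
  rw [cexp_f hc, div_mul_eq_mul_div, div_eq_iff hden, den, cosh_eq_exp_half, sinh_eq_exp_half]
  push_cast [-ofReal_exp]
  generalize (Real.exp (c.α * t / 2) : ℂ) = e at *
  generalize (Real.exp (-(c.α * t / 2)) : ℂ) = e' at *
  linear_combination (e ^ 3 - e') / 2 * (-c.ofReal_rad_sq - 4 * (c.c₁ : ℂ) ^ 2 * I_sq)
    + (e * c.rad * (c.c₅ ^ 2 - 2 * I * c.c₁) + e' * (c.c₅ ^ 2 + 2 * I * c.c₁) ^ 2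
      - e * c.rad * (c.c₅ ^ 2 + 2 * I * c.c₁) - e' * c.rad ^ 2) / 2 * hexp

theorem div_sub_mul (hc : c.c₁ ≠ 0) (t : ℝ) :
    (2 / c.den t - I * c.rad * Real.sinh (c.α * t) / (c.c₁ * c.den t)) *
      (Real.exp (c.α * t / 2) * (c.c₅ ^ 2 + 2 * I * c.c₁) + Real.exp (-(c.α * t / 2)) * c.rad)
      = -(I / c.c₁) * (Real.exp (c.α * t / 2) * (c.c₅ ^ 2 + 2 * I * c.c₁)
        - Real.exp (-(c.α * t / 2)) * c.rad) := by
  have hden := ofReal_ne_zero.2 (den_pos hc t).ne'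
  have : (c.c₁ : ℂ) ≠ 0 := ofReal_ne_zero.2 hc
  have hexp := exp_half_mul_exp_neg_half (c.α * t)
  field_simp
  rw [den, cosh_eq_exp_half, sinh_eq_exp_half]
  push_cast [-ofReal_exp]
  generalize (Real.exp (c.α * t / 2) : ℂ) = e at *
  generalize (Real.exp (-(c.α * t / 2)) : ℂ) = e' at *
  linear_combination -I * c.rad * (e * c.rad - e' * (c.c₅ ^ 2 + 2 * I * c.c₁)) * hexp
    + (2 * c.c₁ * (e * (c.c₅ ^ 2 + 2 * I * c.c₁) + e' * c.rad) - 4 * c.c₁ ^ 2 * e * I) * I_sq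
    - e * I * c.ofReal_rad_sq

theorem Valid.smul_endpoints_add (hc : c.Valid) (t : ℝ) :
    (Real.exp (c.α * t / 2) : ℂ) • c.endpoints.1 + (Real.exp (-(c.α * t / 2)) : ℂ) • c.endpoints.2
      = (Real.exp (c.α * t / 2) * (c.c₅ ^ 2 + 2 * I * c.c₁)
        + Real.exp (-(c.α * t / 2)) * c.rad : ℂ) • lift (c.curve t) := by
  have hexp := cexp_f_mul hc.1 t
  have hdiv := div_sub_mul hc.1 t
  simp only [hc.lift_curve, endpoints, Matrix.smul_cons, Matrix.smul_empty, Matrix.cons_add_cons,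
    Matrix.empty_add_empty, Matrix.vecCons_inj, smul_eq_mul, mul_one, and_true]
  constructor
  · linear_combination -hdiv - 2 * (c.c₃ / c.c₁ : ℂ) * c.c₄ * hexp
  · linear_combination -(c.c₄ : ℂ) * hexp

theorem Valid.exists_isGeodesicLine (hc : c.Valid) :
    ∃ ξ, IsGeodesicLine ξ ∧ ∀ t, c.curve t = ξ (c.α * t) := by
  have hR := rad_pos hc.1
  refine ⟨_, isGeodesicLine_proj (herm_endpoints_fst c) (herm_endpoints_snd c)
    (by positivity : 0 < 4 * c.rad) hc.herm_endpoints, fun t => ?_⟩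
  rw [hc.smul_endpoints_add, proj_smul, proj_lift]
  intro h
  have him := congrArg im h
  simp [hc.1, ← ofReal_pow, -ofReal_exp] at him

end Consts

end ExplicitCurves

section CenteredData

/-! ### Centered boundary data -/

/-- The quantity `√(ω² + 4 ψ⁴ + 4 η₁ ψ²)`, which is `η₁ sinh (α |t|)` for the explicit curve that
passes through `(η₁, ω₁, ψ₁, 0)` at time `t`. -/
def boundaryNorm (η₁ ω₁ ψ₁ : ℝ) : ℝ := √(ω₁ ^ 2 + 4 * ψ₁ ^ 4 + 4 * η₁ * ψ₁ ^ 2)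

/-- The constants of the explicit curve that passes through `(η₁, ω₁, ψ₁, 0)` at time `t < 0`,
found by solving for `η₁ sinh (α t)`, `η₁ cosh (α t)`, `c₅`, `c₁` and `c₃`, in this order. -/
def centeredConsts (t η₁ ω₁ ψ₁ : ℝ) : Consts :=
  let N := boundaryNorm η₁ ω₁ ψ₁
  let M := √(η₁ ^ 2 + N ^ 2)
  let c₅ := 2 * ψ₁ / N
  let c₁ := -ω₁ / (N * M)
  { c₁ := c₁
    c₃ := -(c₅ * (√(4 * c₁ ^ 2 + c₅ ^ 4) * η₁ + c₅ ^ 2 * M)) / 4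
    c₄ := c₅ / (2 * c₁)
    c₅ := c₅
    α := Real.arsinh (N / η₁) / -t }

variable {t η₁ ω₁ ψ₁ : ℝ}

theorem boundaryNorm_pos (hη : 0 < η₁) (hω : ω₁ ≠ 0) (ψ₁ : ℝ) : 0 < boundaryNorm η₁ ω₁ ψ₁ :=
  Real.sqrt_pos.2 (by positivity)

theorem valid_centeredConsts (ht : t < 0) (hη : 0 < η₁) (hω : ω₁ ≠ 0) :
    (centeredConsts t η₁ ω₁ ψ₁).Valid := by
  have hN := boundaryNorm_pos hη hω ψ₁
  have hc₁ : (centeredConsts t η₁ ω₁ ψ₁).c₁ ≠ 0 :=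
    div_ne_zero (neg_ne_zero.2 hω) (by positivity)
  exact ⟨hc₁, (mul_div_cancel₀ _ (mul_ne_zero two_ne_zero hc₁)).symm,
    div_pos (Real.arsinh_pos_iff.2 (by positivity)) (neg_pos.2 ht)⟩

namespace Consts

variable {c : Consts}

theorem Valid.curve_eq_iff (hc : c.Valid) (hη : 0 < η₁) :
    c.curve t = ![η₁, ω₁, ψ₁, 0] ↔ η₁ * c.den t = 2 ∧
      c.c₅ * (η₁ * Real.sinh (c.α * t)) = -(2 * ψ₁) ∧
      c.c₁ * (η₁ * Real.sinh (c.α * t)) * (η₁ * Real.cosh (c.α * t)) = ω₁ ∧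
      c.c₃ = -(c.c₅ * (c.rad * η₁ + c.c₅ ^ 2 * (η₁ * Real.cosh (c.α * t)))) / 4 := by
  have hc₁ := hc.1
  have hden := den_pos hc₁ t
  rw [hc.curve_eq]
  simp only [Matrix.vecCons_inj, and_true]
  rw [div_eq_iff hden.ne', eq_comm (a := (2 : ℝ))]
  refine and_congr_right fun h => ?_
  have hη₂ : c.den t = 2 / η₁ := by rw [eq_div_iff hη.ne', mul_comm, h]
  have hψ : -(c.c₅ * Real.sinh (c.α * t)) / c.den t = ψ₁
      ↔ c.c₅ * (η₁ * Real.sinh (c.α * t)) = -(2 * ψ₁) := by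
    rw [hη₂]
    constructor <;> intro h <;> field_simp at h ⊢ <;> linarith
  have hχ : (c.c₅ * (c.rad + c.c₅ ^ 2 * Real.cosh (c.α * t)) / c.den t + 2 * c.c₃) / (2 * c.c₁) = 0
      ↔ c.c₃ = -(c.c₅ * (c.rad * η₁ + c.c₅ ^ 2 * (η₁ * Real.cosh (c.α * t)))) / 4 := by
    rw [hη₂]
    constructor <;> intro h <;> field_simp at h ⊢ <;> linarith
  have hω (h₃ : c.c₃ = -(c.c₅ * (c.rad * η₁ + c.c₅ ^ 2 * (η₁ * Real.cosh (c.α * t)))) / 4) :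
      (c.rad + 2 * c.c₃ * c.c₅) * Real.sinh (c.α * t) / (c.c₁ * c.den t)
        = c.c₁ * (η₁ * Real.sinh (c.α * t)) * (η₁ * Real.cosh (c.α * t)) := by
    have hrad : c.rad + 2 * c.c₃ * c.c₅ = 2 * c.c₁ ^ 2 * (η₁ * Real.cosh (c.α * t)) := by
      rw [den] at h
      rw [h₃]
      linear_combination -c.rad / 2 * h + η₁ * Real.cosh (c.α * t) / 2 * c.rad_sq
    rw [hrad, hη₂]
    field_simp
  rw [hψ, hχ]
  exact ⟨fun ⟨h₁, h₅, h₃⟩ => ⟨h₅, (hω h₃).symm.trans h₁, h₃⟩,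
    fun ⟨h₅, h₁, h₃⟩ => ⟨(hω h₃).trans h₁, h₅, h₃⟩⟩

theorem sq_mul_cosh (y x : ℝ) : (y * Real.cosh x) ^ 2 = (y * Real.sinh x) ^ 2 + y ^ 2 := by
  rw [mul_pow, Real.cosh_sq]
  ring

theorem rad_mul_sq_eq_iff {X Y : ℝ} (hX : X ≠ 0) (hY : Y ^ 2 = X ^ 2 + η₁ ^ 2)
    (h₅ : c.c₅ * X = -(2 * ψ₁)) :
    (c.rad * Y) ^ 2 = (2 - η₁ * c.c₅ ^ 2) ^ 2
      ↔ X ^ 2 = (c.c₁ * X * Y) ^ 2 + 4 * ψ₁ ^ 4 + 4 * η₁ * ψ₁ ^ 2 := by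
  have key : X ^ 2 * ((c.rad * Y) ^ 2 - (2 - η₁ * c.c₅ ^ 2) ^ 2)
      = 4 * ((c.c₁ * X * Y) ^ 2 + 4 * ψ₁ ^ 4 + 4 * η₁ * ψ₁ ^ 2 - X ^ 2) := by
    obtain rfl : ψ₁ = -(c.c₅ * X) / 2 := by linarith
    linear_combination X ^ 2 * Y ^ 2 * c.rad_sq + c.c₅ ^ 4 * X ^ 2 * hY
  rw [← sub_eq_zero, ← mul_right_inj' (pow_ne_zero 2 hX), key, mul_zero,
    mul_eq_zero_iff_left four_ne_zero, sub_eq_zero, eq_comm]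

theorem Valid.mul_den_eq_two_iff (hc : c.Valid) (ht : t < 0) (hη : 0 < η₁)
    (h₅ : c.c₅ * (η₁ * Real.sinh (c.α * t)) = -(2 * ψ₁))
    (h₁ : c.c₁ * (η₁ * Real.sinh (c.α * t)) * (η₁ * Real.cosh (c.α * t)) = ω₁) :
    η₁ * c.den t = 2 ↔ η₁ * Real.sinh (c.α * t) = -boundaryNorm η₁ ω₁ ψ₁ := by
  have hX : η₁ * Real.sinh (c.α * t) < 0 :=
    mul_neg_of_pos_of_neg hη (Real.sinh_neg_iff.2 (mul_neg_of_pos_of_neg hc.2.2 ht))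
  have hRY : 0 < c.rad * (η₁ * Real.cosh (c.α * t)) :=
    mul_pos (rad_pos hc.1) (mul_pos hη (Real.cosh_pos _))
  have hsq := rad_mul_sq_eq_iff hX.ne (sq_mul_cosh η₁ (c.α * t)) h₅
  rw [h₁] at hsq
  rw [den, mul_add, mul_left_comm η₁ c.rad, ← neg_eq_iff_eq_neg, boundaryNorm, eq_comm (a := -_),
    Real.sqrt_eq_iff_eq_sq (by positivity) (neg_nonneg.2 hX.le), neg_sq, eq_comm (b := _ ^ 2),
    ← hsq]
  constructor
  · intro h
    rw [← h]
    ring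
  · intro h
    have hc₅ : η₁ * c.c₅ ^ 2 ≤ 1 := by
      refine le_of_mul_le_mul_left ?_ (sq_pos_of_neg hX)
      calc (η₁ * Real.sinh (c.α * t)) ^ 2 * (η₁ * c.c₅ ^ 2)
          = 4 * η₁ * ψ₁ ^ 2 := by
            linear_combination η₁ * (c.c₅ * (η₁ * Real.sinh (c.α * t)) - 2 * ψ₁) * h₅
        _ ≤ (η₁ * Real.sinh (c.α * t)) ^ 2 * 1 := by
            rw [hsq.1 h, mul_one]
            exact le_add_of_nonneg_left (by positivity)
    have := (sq_eq_sq₀ hRY.le (by linarith)).1 h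
    linarith

theorem Valid.eq_centeredConsts_iff (hc : c.Valid) :
    c = centeredConsts t η₁ ω₁ ψ₁ ↔ c.α = Real.arsinh (boundaryNorm η₁ ω₁ ψ₁ / η₁) / -t ∧
      c.c₅ = 2 * ψ₁ / boundaryNorm η₁ ω₁ ψ₁ ∧
      c.c₁ = -ω₁ / (boundaryNorm η₁ ω₁ ψ₁ * √(η₁ ^ 2 + boundaryNorm η₁ ω₁ ψ₁ ^ 2)) ∧
      c.c₃ = -(c.c₅ * (c.rad * η₁ + c.c₅ ^ 2 * √(η₁ ^ 2 + boundaryNorm η₁ ω₁ ψ₁ ^ 2))) / 4 := by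
  constructor
  · rintro rfl
    exact ⟨rfl, rfl, rfl, rfl⟩
  · intro h
    have h₄ : c.c₄ = c.c₅ / (2 * c.c₁) :=
      eq_div_of_mul_eq (mul_ne_zero two_ne_zero hc.1) (by rw [mul_comm, hc.2.1])
    obtain ⟨c₁, c₃, c₄, c₅, α⟩ := c
    simp only [rad] at h h₄
    obtain ⟨rfl, h₅, h₁, rfl⟩ := h
    subst h₄ h₅ h₁
    rfl

theorem α_eq_iff (ht : t < 0) (hη : 0 < η₁) (N : ℝ) :
    c.α = Real.arsinh (N / η₁) / -t ↔ η₁ * Real.sinh (c.α * t) = -N := by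
  rw [eq_div_iff (neg_ne_zero.2 ht.ne), ← Real.sinh_inj, Real.sinh_arsinh, eq_div_iff hη.ne',
    mul_neg, Real.sinh_neg, mul_comm _ η₁, mul_neg, neg_eq_iff_eq_neg]

theorem Valid.curve_eq_iff_eq_centeredConsts (hc : c.Valid) (ht : t < 0) (hη : 0 < η₁)
    (hω : ω₁ ≠ 0) : c.curve t = ![η₁, ω₁, ψ₁, 0] ↔ c = centeredConsts t η₁ ω₁ ψ₁ := by
  have hN := boundaryNorm_pos hη hω ψ₁
  have hcosh (h : η₁ * Real.sinh (c.α * t) = -boundaryNorm η₁ ω₁ ψ₁) :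
      η₁ * Real.cosh (c.α * t) = √(η₁ ^ 2 + boundaryNorm η₁ ω₁ ψ₁ ^ 2) := by
    rw [← neg_sq (boundaryNorm _ _ _), ← h, add_comm, ← sq_mul_cosh, Real.sqrt_sq]
    exact mul_nonneg hη.le (Real.cosh_pos _).le
  have hM : 0 < √(η₁ ^ 2 + boundaryNorm η₁ ω₁ ψ₁ ^ 2) := by positivity
  rw [hc.curve_eq_iff hη, hc.eq_centeredConsts_iff, α_eq_iff ht hη, eq_div_iff hN.ne',
    eq_div_iff (mul_pos hN hM).ne']
  constructor
  · rintro ⟨h, h₅, h₁, h₃⟩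
    rw [hc.mul_den_eq_two_iff ht hη h₅ h₁] at h
    rw [h] at h₅ h₁
    rw [← hcosh h]
    exact ⟨h, by linarith, by linarith, h₃⟩
  · rintro ⟨h, h₅, h₁, h₃⟩
    rw [← hcosh h] at h₁ h₃
    have h₅' : c.c₅ * (η₁ * Real.sinh (c.α * t)) = -(2 * ψ₁) := by rw [h]; linarith
    have h₁' : c.c₁ * (η₁ * Real.sinh (c.α * t)) * (η₁ * Real.cosh (c.α * t)) = ω₁ := by
      rw [h]; linarith
    exact ⟨(hc.mul_den_eq_two_iff ht hη h₅' h₁').2 h, h₅', h₁', h₃⟩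

end Consts

end CenteredData

namespace Consts

variable {c : Consts} {t₁ t₂ θ₁ θ₂ : ℝ} {ζ D : ℝ → Fin 4 → ℝ}

theorem Valid.exists_isGeodesicLine_curve_eq (hc : c.Valid) :
    ∃ ξ, IsGeodesicLine ξ ∧ c.curve = fun t => ξ (c.α * t + 0) := by
  obtain ⟨ξ, hξ, hcurve⟩ := hc.exists_isGeodesicLine
  exact ⟨ξ, hξ, funext fun t => by rw [hcurve, add_zero]⟩

theorem Valid.isEnergyMinimizer_curve (hc : c.Valid) (ht : t₁ < t₂) :
    IsEnergyMinimizer t₁ t₂ (c.curve t₁) (c.curve t₂) c.curve := by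
  obtain ⟨ξ, hξ, hcurve⟩ := hc.exists_isGeodesicLine_curve_eq
  rw [hcurve]
  exact hξ.isEnergyMinimizer ht

theorem Valid.eqOn_curve_of_isEnergyMinimizer (hc : c.Valid) (ht : t₁ < t₂)
    (hζ : IsEnergyMinimizer t₁ t₂ (c.curve t₁) (c.curve t₂) ζ) :
    EqOn ζ c.curve (Icc t₁ t₂) := by
  obtain ⟨ξ, hξ, hcurve⟩ := hc.exists_isGeodesicLine_curve_eq
  rw [hcurve] at hζ ⊢
  exact hξ.eqOn_of_isEnergyMinimizer ht hζ

theorem Valid.isAffineMinimizingGeodesic_curve (hc : c.Valid) (ht : t₁ ≤ t₂) :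
    IsAffineMinimizingGeodesic c.curve t₁ t₂ c.α := by
  obtain ⟨ξ, hξ, hcurve⟩ := hc.exists_isGeodesicLine_curve_eq
  exact hξ.isAffineMinimizingGeodesic hc.2.2.le ht fun t _ => congrFun hcurve t

theorem Valid.eqOn_of_isMassMinimizer (hc : c.Valid) (h₁ : 0 < θ₁) (h₁₂ : θ₁ < θ₂) (h₂ : θ₂ < π)
    (hD : IsMassMinimizer θ₁ θ₂ (potentialOf θ₁ (c.curve (tOf θ₁)))
      (potentialOf θ₂ (c.curve (tOf θ₂))) D) :
    EqOn D (fun θ => potentialOf θ (c.curve (tOf θ))) (Icc θ₁ θ₂) ∧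
      EqOn (curveOf D) c.curve (Icc (tOf θ₁) (tOf θ₂)) := by
  obtain ⟨ξ, hξ, hcurve⟩ := hc.exists_isGeodesicLine_curve_eq
  rw [hcurve] at hD ⊢
  have heq := hξ.eqOn_of_isMassMinimizer h₁ h₁₂ h₂ hD
  refine ⟨heq, fun t ht => ?_⟩
  rw [← hξ.eqOn_curveOf_linePotentials h₁ h₁₂.le h₂ ht]
  exact congrArg (pointOf (thetaOf t)) (heq (thetaOf_mem_Icc h₁ h₁₂.le h₂ ht))

theorem log_eta_sub (hc : c.c₁ ≠ 0) {s : ℝ} (hs : 0 < s) (t : ℝ) :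
    Real.log (c.eta t) - 2 * Real.log s = -Real.log (1 / 2 * c.c₅ ^ 2 * s ^ 2
      + 1 / 2 * √(4 * c.c₁ ^ 2 + c.c₅ ^ 4) * s ^ 2 * Real.cosh (c.α * t)) := by
  have hden := den_pos hc t
  have hsum : 1 / 2 * c.c₅ ^ 2 * s ^ 2 + 1 / 2 * √(4 * c.c₁ ^ 2 + c.c₅ ^ 4) * s ^ 2
      * Real.cosh (c.α * t) = s ^ 2 / (2 / c.den t) := by
    rw [den, rad]
    field_simp
  rw [hsum, eta_eq, Real.log_div (pow_pos hs 2).ne' (div_pos two_pos hden).ne', Real.log_pow,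
    neg_sub, Nat.cast_two]

end Consts

theorem tOf_neg {θ : ℝ} (h₀ : 0 < θ) (hπ : θ < π / 2) : tOf θ < 0 :=
  Real.log_neg (tan_half_pos h₀ (by linarith)) (Real.tan_pi_div_four ▸
    Real.tan_lt_tan_of_lt_of_lt_pi_div_two (by linarith) (by linarith) (by linarith))

theorem tOf_pi_sub (θ : ℝ) : tOf (π - θ) = -tOf θ := by
  rw [tOf, tOf, sub_div, Real.tan_pi_div_two_sub, Real.log_inv]

theorem curve_centeredConsts {t η₁ ω₁ ψ₁ : ℝ} (ht : t < 0) (hη : 0 < η₁) (hω : ω₁ ≠ 0) :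
    (centeredConsts t η₁ ω₁ ψ₁).curve t = ![η₁, ω₁, ψ₁, 0] :=
  ((valid_centeredConsts ht hη hω).curve_eq_iff_eq_centeredConsts ht hη hω).2 rfl

theorem curve_centeredConsts_neg {t η₁ ω₁ ψ₁ : ℝ} (ht : t < 0) (hη : 0 < η₁) (hω : ω₁ ≠ 0) :
    (centeredConsts t η₁ ω₁ ψ₁).curve (-t) = ![η₁, -ω₁, -ψ₁, 0] := by
  rw [(valid_centeredConsts ht hη hω).curve_neg, curve_centeredConsts ht hη hω]
  rfl

theorem exists_consts_isEnergyMinimizer {t₁ η₁ ω₁ ψ₁ : ℝ} (ht : t₁ < 0) (hη : 0 < η₁)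
    (hω : ω₁ ≠ 0) :
    ∃ c : Consts,
      (c.Valid ∧ c.curve t₁ = ![η₁, ω₁, ψ₁, 0] ∧ c.curve (-t₁) = ![η₁, -ω₁, -ψ₁, 0]) ∧
      (∀ c' : Consts, c'.Valid → c'.curve t₁ = ![η₁, ω₁, ψ₁, 0] →
        c'.curve (-t₁) = ![η₁, -ω₁, -ψ₁, 0] → c' = c) ∧
      IsEnergyMinimizer t₁ (-t₁) ![η₁, ω₁, ψ₁, 0] ![η₁, -ω₁, -ψ₁, 0] c.curve ∧
      (∀ ζ, IsEnergyMinimizer t₁ (-t₁) ![η₁, ω₁, ψ₁, 0] ![η₁, -ω₁, -ψ₁, 0] ζ →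
        EqOn ζ c.curve (Icc t₁ (-t₁))) ∧
      IsAffineMinimizingGeodesic c.curve t₁ (-t₁) c.α := by
  have hc := valid_centeredConsts (ψ₁ := ψ₁) ht hη hω
  have hl := curve_centeredConsts (ψ₁ := ψ₁) ht hη hω
  have hr := curve_centeredConsts_neg (ψ₁ := ψ₁) ht hη hω
  have ht' : t₁ < -t₁ := by linarith
  refine ⟨centeredConsts t₁ η₁ ω₁ ψ₁, ⟨hc, hl, hr⟩,
    fun c' hc' hl' _ => (hc'.curve_eq_iff_eq_centeredConsts ht hη hω).1 hl', ?_⟩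
  rw [← hl, ← hr]
  exact ⟨hc.isEnergyMinimizer_curve ht', fun ζ hζ => hc.eqOn_curve_of_isEnergyMinimizer ht' hζ,
    hc.isAffineMinimizingGeodesic_curve ht'.le⟩

section Centered

variable {θ σ₁ ω₁ ψ₁ : ℝ} {D : ℝ → Fin 4 → ℝ}

/-- The constants of the explicit curve given by the minimizer of the mass functional on
`[θ, π - θ]` with the centered Dirichlet data `(σ₁, ω₁, ψ₁, 0)` at `θ`. -/
def massConsts (θ σ₁ ω₁ ψ₁ : ℝ) : Consts :=
  centeredConsts (tOf θ) (Real.exp σ₁ * Real.sin θ ^ 2) ω₁ ψ₁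

theorem exp_mul_sin_sq_pos (h₀ : 0 < θ) (hπ : θ < π / 2) (σ₁ : ℝ) :
    0 < Real.exp σ₁ * Real.sin θ ^ 2 :=
  mul_pos (Real.exp_pos _) (pow_pos (Real.sin_pos_of_pos_of_lt_pi h₀ (by linarith)) 2)

theorem valid_massConsts (h₀ : 0 < θ) (hπ : θ < π / 2) (hω : ω₁ ≠ 0) :
    (massConsts θ σ₁ ω₁ ψ₁).Valid :=
  valid_centeredConsts (tOf_neg h₀ hπ) (exp_mul_sin_sq_pos h₀ hπ σ₁) hω

theorem potentialOf_curve_massConsts (h₀ : 0 < θ) (hπ : θ < π / 2) (hω : ω₁ ≠ 0) :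
    potentialOf θ ((massConsts θ σ₁ ω₁ ψ₁).curve (tOf θ)) = ![σ₁, ω₁, ψ₁, 0] := by
  rw [massConsts, curve_centeredConsts (tOf_neg h₀ hπ) (exp_mul_sin_sq_pos h₀ hπ σ₁) hω]
  exact potentialOf_pointOf (Real.sin_pos_of_pos_of_lt_pi h₀ (by linarith)) ![σ₁, ω₁, ψ₁, 0]

theorem potentialOf_curve_massConsts_pi_sub (h₀ : 0 < θ) (hπ : θ < π / 2) (hω : ω₁ ≠ 0) :
    potentialOf (π - θ) ((massConsts θ σ₁ ω₁ ψ₁).curve (tOf (π - θ)))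
      = ![σ₁, -ω₁, -ψ₁, 0] := by
  rw [tOf_pi_sub, massConsts,
    curve_centeredConsts_neg (tOf_neg h₀ hπ) (exp_mul_sin_sq_pos h₀ hπ σ₁) hω, ← Real.sin_pi_sub]
  exact potentialOf_pointOf (Real.sin_pos_of_pos_of_lt_pi (by linarith) (by linarith))
    ![σ₁, -ω₁, -ψ₁, 0]

theorem explicit_of_isMassMinimizer (h₀ : 0 < θ) (hπ : θ < π / 2) (hω : ω₁ ≠ 0)
    (hD : IsMassMinimizer θ (π - θ) ![σ₁, ω₁, ψ₁, 0] ![σ₁, -ω₁, -ψ₁, 0] D) :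
    (massConsts θ σ₁ ω₁ ψ₁).Valid ∧
      EqOn (curveOf D) (massConsts θ σ₁ ω₁ ψ₁).curve (Icc (tOf θ) (tOf (π - θ))) ∧
      ∀ x ∈ Icc θ (π - θ), D x 0 = -Real.log
        (1 / 2 * (massConsts θ σ₁ ω₁ ψ₁).c₅ ^ 2 * Real.sin x ^ 2 +
          1 / 2 * √(4 * (massConsts θ σ₁ ω₁ ψ₁).c₁ ^ 2 + (massConsts θ σ₁ ω₁ ψ₁).c₅ ^ 4) *
            Real.sin x ^ 2 * Real.cosh ((massConsts θ σ₁ ω₁ ψ₁).α * tOf x)) := by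
  have hc := valid_massConsts (σ₁ := σ₁) (ψ₁ := ψ₁) h₀ hπ hω
  have hθ : π - θ < π := by linarith
  rw [← potentialOf_curve_massConsts h₀ hπ hω, ← potentialOf_curve_massConsts_pi_sub h₀ hπ hω] at hD
  obtain ⟨heq, hcurve⟩ := hc.eqOn_of_isMassMinimizer h₀ (by linarith) hθ hD
  exact ⟨hc, hcurve, fun x hx => (congrFun (heq hx) 0).trans
    (Consts.log_eta_sub hc.1 (sin_pos_of_mem_Icc h₀ hθ hx) (tOf x))⟩

end Centered

section Limits

theorem tendsto_tOf_atBot : Tendsto tOf (𝓝[>] 0) atBot := by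
  refine Real.tendsto_log_nhdsGT_zero.comp (tendsto_nhdsWithin_iff.2 ⟨?_, ?_⟩)
  · have htan : ContinuousAt (fun θ : ℝ => Real.tan (θ / 2)) 0 :=
      ContinuousAt.comp' (Real.continuousAt_tan.2 (by simp)) (by fun_prop)
    simpa using! htan.tendsto.mono_left nhdsWithin_le_nhds
  · filter_upwards [Ioo_mem_nhdsGT Real.pi_pos] with θ hθ
    exact tan_half_pos hθ.1 hθ.2

theorem tendsto_log_half_sub_tOf :
    Tendsto (fun θ => Real.log (θ / 2) - tOf θ) (𝓝[>] 0) (𝓝 0) := by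
  have hcont : ContinuousAt (fun θ => Real.log (Real.cos (θ / 2) / Real.sinc (θ / 2))) 0 := by
    have hsinc : ContinuousAt (fun θ : ℝ => Real.sinc (θ / 2)) 0 :=
      Real.continuous_sinc.continuousAt.comp' (by fun_prop)
    exact ContinuousAt.log (.div (by fun_prop) hsinc (by simp)) (by simp)
  have hlim := hcont.tendsto.mono_left (nhdsWithin_le_nhds (s := Ioi 0))
  simp only [zero_div, Real.cos_zero, Real.sinc_zero, div_one, Real.log_one] at hlim
  refine hlim.congr' ?_
  filter_upwards [Ioo_mem_nhdsGT Real.pi_pos] with θ ⟨h₀, hπ⟩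
  rw [tOf, ← Real.log_div (by positivity) (tan_half_pos h₀ hπ).ne', Real.tan_eq_sin_div_cos,
    Real.sinc_of_ne_zero (by positivity), div_div_eq_mul_div, div_div_eq_mul_div, mul_comm]

theorem tendsto_log_sin_sub_tOf :
    Tendsto (fun θ => Real.log (Real.sin θ) - tOf θ) (𝓝[>] 0) (𝓝 (Real.log 2)) := by
  have hcont : ContinuousAt (fun θ : ℝ => Real.log (2 * Real.cos (θ / 2) ^ 2)) 0 :=
    ContinuousAt.log (by fun_prop) (by simp)
  have hlim := hcont.tendsto.mono_left (nhdsWithin_le_nhds (s := Ioi 0))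
  simp only [zero_div, Real.cos_zero, one_pow, mul_one] at hlim
  refine hlim.congr' ?_
  filter_upwards [Ioo_mem_nhdsGT Real.pi_pos] with θ ⟨h₀, hπ⟩
  have hsin : 0 < Real.sin (θ / 2) := Real.sin_pos_of_pos_of_lt_pi (by linarith) (by linarith)
  rw [tOf, ← Real.log_div (Real.sin_pos_of_pos_of_lt_pi h₀ hπ).ne' (tan_half_pos h₀ hπ).ne',
    Real.tan_eq_sin_div_cos, sin_eq_two_mul_sin_half_mul_cos_half]
  field_simp

theorem arsinh_div {N η : ℝ} (hN : 0 < N) (hη : 0 < η) :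
    Real.arsinh (N / η) = Real.log (N + √(η ^ 2 + N ^ 2)) - Real.log η := by
  have hsqrt : √(1 + (N / η) ^ 2) = √(η ^ 2 + N ^ 2) / η := by
    rw [div_pow, one_add_div (pow_pos hη 2).ne', Real.sqrt_div (by positivity), Real.sqrt_sq hη.le]
  rw [Real.arsinh, hsqrt, ← add_div, Real.log_div (by positivity) hη.ne']

theorem massConsts_α_sub_two_mul {θ σ₁ ω₁ ψ₁ : ℝ} (h₀ : 0 < θ) (hπ : θ < π / 2) (hω : ω₁ ≠ 0) :
    ((massConsts θ σ₁ ω₁ ψ₁).α - 2) * tOf θ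
      = σ₁ + 2 * (Real.log (Real.sin θ) - tOf θ)
        - Real.log (boundaryNorm (Real.exp σ₁ * Real.sin θ ^ 2) ω₁ ψ₁
          + √((Real.exp σ₁ * Real.sin θ ^ 2) ^ 2
            + boundaryNorm (Real.exp σ₁ * Real.sin θ ^ 2) ω₁ ψ₁ ^ 2)) := by
  have hsin := Real.sin_pos_of_pos_of_lt_pi h₀ (by linarith)
  have hη := exp_mul_sin_sq_pos h₀ hπ σ₁
  have hlog : Real.log (Real.exp σ₁ * Real.sin θ ^ 2) = σ₁ + 2 * Real.log (Real.sin θ) := by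
    rw [Real.log_mul (Real.exp_ne_zero _) (by positivity), Real.log_exp, Real.log_pow]
    norm_num
  have hα : (massConsts θ σ₁ ω₁ ψ₁).α * tOf θ
      = -Real.arsinh (boundaryNorm (Real.exp σ₁ * Real.sin θ ^ 2) ω₁ ψ₁
        / (Real.exp σ₁ * Real.sin θ ^ 2)) := by
    rw [massConsts, centeredConsts, div_neg, neg_mul, div_mul_cancel₀ _ (tOf_neg h₀ hπ).ne]
  rw [sub_mul, hα, arsinh_div (boundaryNorm_pos hη hω ψ₁) hη, hlog]
  ring

variable {ι : Type*} {l : Filter ι} {J Q σl Γ : ℝ} {t η θ σ₁ ω₁ ψ₁ α : ι → ℝ}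

theorem tendsto_boundaryNorm (hη : Tendsto η l (𝓝 0)) (hω : Tendsto ω₁ l (𝓝 (-4 * J)))
    (hψ : Tendsto ψ₁ l (𝓝 (-Q))) :
    Tendsto (fun i => boundaryNorm (η i) (ω₁ i) (ψ₁ i)) l (𝓝 (2 * √(Q ^ 4 + 4 * J ^ 2))) := by
  have hlim := (((hω.pow 2).add ((hψ.pow 4).const_mul 4)).add
    ((hη.const_mul 4).mul (hψ.pow 2))).sqrt
  have hval : √((-4 * J) ^ 2 + 4 * (-Q) ^ 4 + 4 * 0 * (-Q) ^ 2) = 2 * √(Q ^ 4 + 4 * J ^ 2) := by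
    rw [Real.sqrt_eq_iff_mul_self_eq (by positivity) (by positivity), mul_mul_mul_comm,
      Real.mul_self_sqrt (by positivity)]
    ring
  exact hval ▸ hlim

theorem tendsto_sqrt_sq_add_boundaryNorm_sq (hη : Tendsto η l (𝓝 0))
    (hω : Tendsto ω₁ l (𝓝 (-4 * J))) (hψ : Tendsto ψ₁ l (𝓝 (-Q))) :
    Tendsto (fun i => √(η i ^ 2 + boundaryNorm (η i) (ω₁ i) (ψ₁ i) ^ 2)) l
      (𝓝 (2 * √(Q ^ 4 + 4 * J ^ 2))) := by
  have hlim := ((hη.pow 2).add ((tendsto_boundaryNorm hη hω hψ).pow 2)).sqrt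
  rwa [zero_pow two_ne_zero, zero_add, Real.sqrt_sq (by positivity)] at hlim

theorem tendsto_centeredConsts_c₅ (hJQ : 0 < Q ^ 4 + 4 * J ^ 2) (hη : Tendsto η l (𝓝 0))
    (hω : Tendsto ω₁ l (𝓝 (-4 * J))) (hψ : Tendsto ψ₁ l (𝓝 (-Q))) :
    Tendsto (fun i => (centeredConsts (t i) (η i) (ω₁ i) (ψ₁ i)).c₅) l
      (𝓝 (-Q / √(Q ^ 4 + 4 * J ^ 2))) := by
  have hlim := (hψ.const_mul 2).div (tendsto_boundaryNorm hη hω hψ) (by positivity)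
  rwa [mul_div_mul_left _ _ two_ne_zero] at hlim

theorem tendsto_centeredConsts_c₁ (hJQ : 0 < Q ^ 4 + 4 * J ^ 2) (hη : Tendsto η l (𝓝 0))
    (hω : Tendsto ω₁ l (𝓝 (-4 * J))) (hψ : Tendsto ψ₁ l (𝓝 (-Q))) :
    Tendsto (fun i => (centeredConsts (t i) (η i) (ω₁ i) (ψ₁ i)).c₁) l
      (𝓝 (J / (Q ^ 4 + 4 * J ^ 2))) := by
  have hlim := hω.neg.div ((tendsto_boundaryNorm hη hω hψ).mul
    (tendsto_sqrt_sq_add_boundaryNorm_sq hη hω hψ)) (by positivity)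
  have hval : -(-4 * J) / (2 * √(Q ^ 4 + 4 * J ^ 2) * (2 * √(Q ^ 4 + 4 * J ^ 2)))
      = J / (Q ^ 4 + 4 * J ^ 2) := by
    rw [mul_mul_mul_comm, Real.mul_self_sqrt hJQ.le, neg_mul, neg_neg]
    exact (congrArg (4 * J / ·) (by ring)).trans (mul_div_mul_left _ _ four_ne_zero)
  exact hval ▸ hlim

theorem tendsto_exp_mul_sin_sq {x : ℝ} (hσ : Tendsto σ₁ l (𝓝 x)) (hθ : Tendsto θ l (𝓝[>] 0)) :
    Tendsto (fun i => Real.exp (σ₁ i) * Real.sin (θ i) ^ 2) l (𝓝 0) := by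
  have hsin : Tendsto (fun i => Real.sin (θ i)) l (𝓝 0) := by
    simpa using! (Real.continuous_sin.tendsto 0).comp (hθ.mono_right nhdsWithin_le_nhds)
  simpa using! ((Real.continuous_exp.tendsto x).comp hσ).mul (hsin.pow 2)

theorem tendsto_massConsts_α_sub_two_mul (hJQ : 0 < Q ^ 4 + 4 * J ^ 2)
    (hσl : σl = 1 / 2 * Real.log (Q ^ 4 + 4 * J ^ 2) + Γ) (hθπ : ∀ i, 0 < θ i ∧ θ i < π / 2)
    (hθ : Tendsto θ l (𝓝[>] 0)) (hσ : Tendsto σ₁ l (𝓝 σl)) (hω : Tendsto ω₁ l (𝓝 (-4 * J)))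
    (hψ : Tendsto ψ₁ l (𝓝 (-Q))) (hω₀ : ∀ i, ω₁ i ≠ 0) :
    Tendsto (fun i => ((massConsts (θ i) (σ₁ i) (ω₁ i) (ψ₁ i)).α - 2) * tOf (θ i)) l (𝓝 Γ) := by
  have hη := tendsto_exp_mul_sin_sq hσ hθ
  have hlim := (hσ.add ((tendsto_log_sin_sub_tOf.comp hθ).const_mul 2)).sub
    (((tendsto_boundaryNorm hη hω hψ).add
      (tendsto_sqrt_sq_add_boundaryNorm_sq hη hω hψ)).log (by positivity))
  have hval : σl + 2 * Real.log 2
      - Real.log (2 * √(Q ^ 4 + 4 * J ^ 2) + 2 * √(Q ^ 4 + 4 * J ^ 2)) = Γ := by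
    rw [← two_mul, ← mul_assoc, ← sq, Real.log_mul (by norm_num) (by positivity), Real.log_pow,
      Real.log_sqrt hJQ.le, hσl]
    push_cast
    ring
  rw [hval] at hlim
  exact hlim.congr fun i => (massConsts_α_sub_two_mul (hθπ i).1 (hθπ i).2 (hω₀ i)).symm

theorem tendsto_zero_of_mul_tOf (hθ : Tendsto θ l (𝓝[>] 0))
    (hα : Tendsto (fun i => α i * tOf (θ i)) l (𝓝 Γ)) : Tendsto α l (𝓝 0) := by
  have ht := tendsto_tOf_atBot.comp hθ
  refine (hα.div_atBot ht).congr' ((ht.eventually_lt_atBot 0).mono fun i hi => ?_)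
  exact mul_div_cancel_right₀ _ hi.ne

theorem tendsto_half_rpow_of_mul_tOf (hθ : Tendsto θ l (𝓝[>] 0))
    (hα : Tendsto (fun i => α i * tOf (θ i)) l (𝓝 Γ)) :
    Tendsto (fun i => (θ i / 2) ^ α i) l (𝓝 (Real.exp Γ)) := by
  have hlog := hα.add ((tendsto_zero_of_mul_tOf hθ hα).mul (tendsto_log_half_sub_tOf.comp hθ))
  rw [mul_zero, add_zero] at hlog
  refine ((Real.continuous_exp.tendsto Γ).comp hlog).congr' ?_
  filter_upwards [hθ.eventually_mem self_mem_nhdsWithin] with i hi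
  rw [Real.rpow_def_of_pos (half_pos hi)]
  simp only [Function.comp_apply]
  ring_nf

theorem tendsto_massConsts (hJQ : J ≠ 0 ∨ Q ≠ 0)
    (hσl : σl = 1 / 2 * Real.log (Q ^ 4 + 4 * J ^ 2) + Γ) (hθπ : ∀ i, 0 < θ i ∧ θ i < π / 2)
    (hθ : Tendsto θ l (𝓝 0)) (hσ : Tendsto σ₁ l (𝓝 σl)) (hω : Tendsto ω₁ l (𝓝 (-4 * J)))
    (hψ : Tendsto ψ₁ l (𝓝 (-Q))) (hω₀ : ∀ i, ω₁ i ≠ 0) :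
    Tendsto (fun i => (massConsts (θ i) (σ₁ i) (ω₁ i) (ψ₁ i)).α) l (𝓝 2) ∧
    Tendsto (fun i => (massConsts (θ i) (σ₁ i) (ω₁ i) (ψ₁ i)).c₅) l
      (𝓝 (-Q / √(Q ^ 4 + 4 * J ^ 2))) ∧
    Tendsto (fun i => (massConsts (θ i) (σ₁ i) (ω₁ i) (ψ₁ i)).c₁) l
      (𝓝 (J / (Q ^ 4 + 4 * J ^ 2))) ∧
    Tendsto (fun i => (θ i / 2) ^ ((massConsts (θ i) (σ₁ i) (ω₁ i) (ψ₁ i)).α - 2)) l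
      (𝓝 (Real.exp Γ)) := by
  have hpos : 0 < Q ^ 4 + 4 * J ^ 2 := by rcases hJQ with h | h <;> positivity
  replace hθ : Tendsto θ l (𝓝[>] 0) :=
    tendsto_nhdsWithin_iff.2 ⟨hθ, .of_forall fun i => (hθπ i).1⟩
  have hη := tendsto_exp_mul_sin_sq hσ hθ
  have hα := tendsto_massConsts_α_sub_two_mul hpos hσl hθπ hθ hσ hω hψ hω₀
  exact ⟨by simpa using (tendsto_zero_of_mul_tOf hθ hα).add_const 2,
    tendsto_centeredConsts_c₅ hpos hη hω hψ, tendsto_centeredConsts_c₁ hpos hη hω hψ,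
    tendsto_half_rpow_of_mul_tOf hθ hα⟩

end Limits

end CH2

end

theorem lemma4 :
    -- (1) existence, uniqueness, smoothness and geodesic nature of the minimizer
    (∀ (θ₁ θ₂ : ℝ) (p q : Fin 4 → ℝ), 0 < θ₁ → θ₁ < θ₂ → θ₂ < π →
      ∃ D : ℝ → Fin 4 → ℝ,
        IsMassMinimizer θ₁ θ₂ p q D ∧
        (∀ E, IsMassMinimizer θ₁ θ₂ p q E → EqOn E D (Icc θ₁ θ₂)) ∧
        ContDiffOn ℝ ∞ D (Icc θ₁ θ₂) ∧
        ∃ α : ℝ, IsAffineMinimizingGeodesic (curveOf D) (tOf θ₁) (tOf θ₂) α) ∧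
    -- (2) the explicit minimizer for centered boundary data
    (∀ t₁ η₁ ω₁ ψ₁ : ℝ, t₁ < 0 → 0 < η₁ → ω₁ ≠ 0 →
      ∃ c : Consts,
        (c.Valid ∧ c.curve t₁ = ![η₁, ω₁, ψ₁, 0] ∧ c.curve (-t₁) = ![η₁, -ω₁, -ψ₁, 0]) ∧
        (∀ c' : Consts, c'.Valid → c'.curve t₁ = ![η₁, ω₁, ψ₁, 0] →
          c'.curve (-t₁) = ![η₁, -ω₁, -ψ₁, 0] → c' = c) ∧
        IsEnergyMinimizer t₁ (-t₁) ![η₁, ω₁, ψ₁, 0] ![η₁, -ω₁, -ψ₁, 0] c.curve ∧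
        (∀ ζ, IsEnergyMinimizer t₁ (-t₁) ![η₁, ω₁, ψ₁, 0] ![η₁, -ω₁, -ψ₁, 0] ζ →
          EqOn ζ c.curve (Icc t₁ (-t₁))) ∧
        IsAffineMinimizingGeodesic c.curve t₁ (-t₁) c.α) ∧
    -- (3) the limit in which the end points tend to the poles
    (∀ (J Q σl Γ : ℝ) (θ σ₁ ω₁ ψ₁ : ℕ → ℝ) (D : ℕ → ℝ → Fin 4 → ℝ),
      (J ≠ 0 ∨ Q ≠ 0) →
      σl = 1 / 2 * Real.log (Q ^ 4 + 4 * J ^ 2) + Γ →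
      (∀ i, 0 < θ i ∧ θ i < π / 2) → Tendsto θ atTop (𝓝 0) →
      Tendsto σ₁ atTop (𝓝 σl) → Tendsto ω₁ atTop (𝓝 (-4 * J)) → Tendsto ψ₁ atTop (𝓝 (-Q)) →
      (∀ i, ω₁ i ≠ 0) →
      (∀ i, IsMassMinimizer (θ i) (π - θ i)
        ![σ₁ i, ω₁ i, ψ₁ i, 0] ![σ₁ i, -ω₁ i, -ψ₁ i, 0] (D i)) →
      ∃ c : ℕ → Consts,
        (∀ i, (c i).Valid ∧
          EqOn (curveOf (D i)) (c i).curve (Icc (tOf (θ i)) (tOf (π - θ i))) ∧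
          ∀ x ∈ Icc (θ i) (π - θ i),
            D i x 0 = -Real.log (1 / 2 * (c i).c₅ ^ 2 * Real.sin x ^ 2
              + 1 / 2 * √(4 * (c i).c₁ ^ 2 + (c i).c₅ ^ 4) * Real.sin x ^ 2
                * Real.cosh ((c i).α * tOf x))) ∧
        Tendsto (fun i => (c i).α) atTop (𝓝 2) ∧
        Tendsto (fun i => (c i).c₅) atTop (𝓝 (-Q / √(Q ^ 4 + 4 * J ^ 2))) ∧
        Tendsto (fun i => (c i).c₁) atTop (𝓝 (J / (Q ^ 4 + 4 * J ^ 2))) ∧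
        Tendsto (fun i => (θ i / 2) ^ ((c i).α - 2)) atTop (𝓝 (Real.exp Γ))) := by
  refine ⟨fun θ₁ θ₂ p q h₁ h₁₂ h₂ => exists_isMassMinimizer h₁ h₁₂ h₂ p q,
    fun t₁ η₁ ω₁ ψ₁ ht hη hω => exists_consts_isEnergyMinimizer ht hη hω, ?_⟩
  intro J Q σl Γ θ σ₁ ω₁ ψ₁ D hJQ hσl hθπ hθ hσ hω hψ hω₀ hD
  exact ⟨fun i => massConsts (θ i) (σ₁ i) (ω₁ i) (ψ₁ i),
    fun i => explicit_of_isMassMinimizer (hθπ i).1 (hθπ i).2 (hω₀ i) (hD i),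
    tendsto_massConsts hJQ hσl hθπ hθ hσ hω hψ hω₀⟩
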